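/- **Setting.** Let $k\ge 2$, $V=\mathbb C^k$ with volume form $\xi=e_1\wedge\dots\wedge e_k$, and let $\mathbb S=(\mathbf S,\mathbb M)$ be an oriented marked surface: $\mathbf S$ is a compact connected oriented smooth surface, possibly with boundary, and $\mathbb M$ is a non-empty finite set of marked points, each of which is either a *puncture* (an interior point of $\mathbf S$) or a *boundary point* (on $\partial\mathbf S$), with at least one on every boundary component. An *affine flag* $F$ consists of tensors $F_{(i)}\in\bigwedge^iV$ ($0\le i\le k$), $F_{(0)}=1$, $F_{(k)}=\xi$, such that $F_{(i+1)}\in F_{(i)}\wedge V$ for all $i<k$. Let $\mathcal M$ be the moduli space of twisted decorated $\mathrm{SL}_k$-local systems $z$ on $\mathbb S$ (local systems on the space of nonzero tangent vectors of the punctured surface, with monodromy $(-1)^{k-1}$ around the fibres; for odd $k$ these are just local systems on the punctured surface) with an affine flag $F_p$ at every puncture $p$, stabilized by the monodromy $u_p$ around $p$, and at every boundary point either an affine flag (Fock–Goncharov version) or a vector (Grassmannian version). The statement below holds for both versions. **Weyl group action.** For an affine flag $F$ stabilized by $u\in\mathrm{SL}_k$ and $1\le i\le k-1$, choose $v$ with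 $F_{(i+1)}=F_{(i)}\wedge v$; then $s_i\cdot F$ is the affine flag whose $i$th step is $F_{(i-1)}\wedge(u(v)-v)$ and whose other steps are those of $F$ (defined if $u(v)-v\notin\operatorname{span}F_{(i-1)}$). This gives a rational action of the symmetric group $W$ on affine flags stabilized by $u$, in which $(w\cdot F)_{(a)}$ depends only on $w([a])$; here $s_{i_1}s_{i_2}\cdots s_{i_r}$, whose one-line notation arises from the identity by interchanging the symbols in positions $i_1,i_1+1$, then in positions $i_2,i_2+1$, and so on, acts by applying first $s_{i_1}$, then $s_{i_2}$, and so on. **Diagrams.** A *tensor diagram* $T$ is a finite acyclic directed graph immersed in $\mathbf S$ (up to isotopy), with edges labelled by weights in $\{1,\dots,k\}$. Marked points are vertices and are sources; every other vertex lies in the interior of the punctured surface and is of one of four kinds: an exterior product vertex (incoming weights $a_1,\dots,a_m$, one outgoing edge of weight $\sum a_j$); a dual exterior product vertex (one incoming edge of weight $\sum a_j$, outgoing weights $a_1,\dots,a_m$); a coevaluation leaf (a source with one outgoing edge, of weight $k$); an evaluation leaf (a sink with one incoming edge, of weight $k$). In the Grassmannian version edges at boundary points have weight $1$. A *leg* of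 $T$ is an edge at a puncture. A *pseudotagging* $\varphi$ of $T$ assigns to every leg $e$ a subset $\varphi(e)\subseteq\{1,\dots,k\}$ with $|\varphi(e)|=\mathrm{wt}(e)$. It is a *tagging* if for any two legs $e,e'$ at the same puncture $\varphi(e)\subseteq\varphi(e')$ or $\varphi(e')\subseteq\varphi(e)$. **Invariants.** The invariant $[(T,\varphi)]$ is the rational function on $\mathcal M$ whose value at $z$ is obtained by taking the tensor $(w_e\cdot F_p)_{(\mathrm{wt}(e))}$ for each leg $e$ at a puncture $p$, where $w_e([\mathrm{wt}(e)])=\varphi(e)$, the $\mathrm{wt}(e)$th step of the flag (or the vector) for each edge $e$ at a boundary point, and $\xi$ for each coevaluation leaf, and applying to their tensor product the map to $\mathbb C$ that is composed of parallel transport along the edges, exterior products, dual exterior products $\bigwedge^{\sum a_j}V\to\bigotimes_j\bigwedge^{a_j}V$ and evaluations $\bigwedge^kV\cong\mathbb C$ at the vertices. (For even $k$, immersed edges are lifted to the space of nonzero tangent vectors; other choices of lifts change the invariant by a sign only.) All these functions are defined where the Weyl group actions at all punctures are defined. Let $\mathrm{Sk}^{\bowtie}(\mathcal M)$ be the algebra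 generated by all $[(T,\varphi)]$ with $\varphi$ a pseudotagging. **Theorem.** For every tensor diagram $T$ and every pseudotagging $\varphi$ of $T$, the invariant $[(T,\varphi)]$ is a $\mathbb Q$-linear combination of invariants $[(T',\varphi')]$ where $\varphi'$ is a tagging of the tensor diagram $T'$. Consequently $\mathrm{Sk}^{\bowtie}(\mathcal M)$ is, as a vector space, the linear span of the tagged diagram invariants; in particular this span is an algebra. (This holds both over $\mathbb Q$ and over $\mathbb C$.) -/

import Mathlib

open scoped Manifold ContDiff

noncomputable section

/-! ### Oriented marked surfaces -/

/-- The Euclidean plane. -/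
abbrev Plane : Type := EuclideanSpace ℝ (Fin 2)

namespace Plane

/-- The unit circle, run through once counterclockwise for `t ∈ [0, 1]`. -/
def circle (t : ℝ) : Plane := !₂[Real.cos (2 * Real.pi * t), Real.sin (2 * Real.pi * t)]

/-- The (unit) velocity of the counterclockwise unit circle. -/
def velocity (t : ℝ) : Plane := !₂[-Real.sin (2 * Real.pi * t), Real.cos (2 * Real.pi * t)]

theorem continuous_circle : Continuous circle := by
  unfold circle; fun_prop

theorem continuous_velocity : Continuous velocity := by
  unfold velocity; fun_prop

theorem circle_one : circle 1 = circle 0 := by simp [circle]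

theorem velocity_one : velocity 1 = velocity 0 := by simp [velocity]

theorem norm_circle (t : ℝ) : ‖circle t‖ = 1 := by
  simp [circle, EuclideanSpace.norm_eq, Fin.sum_univ_two]

theorem velocity_ne_zero (t : ℝ) : velocity t ≠ 0 := by
  intro h
  have h0 : velocity t 0 = 0 := by rw [h]; rfl
  have h1 : velocity t 1 = 0 := by rw [h]; rfl
  simp only [velocity, PiLp.toLp_apply, Matrix.cons_val_zero, Matrix.cons_val_one, neg_eq_zero]
    at h0 h1
  have := Real.sin_sq_add_cos_sq (2 * Real.pi * t)
  rw [h0, h1] at this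
  norm_num at this

end Plane

variable (S : Type*) [TopologicalSpace S] [ChartedSpace (EuclideanHalfSpace 2) S]
  [IsManifold (𝓡∂ 2) ∞ S]

/-- A smooth, orientation preserving parametrized disk in the interior of the surface `S` with
centre `p`, which contains no other point of the finite set `P`. -/
structure PuncturedDisk (P : Finset S) (p : S) where
  chart : OpenPartialHomeomorph S Plane
  mem_source : p ∈ chart.source
  map_centre : chart p = 0
  closedBall_subset : Metric.closedBall 0 1 ⊆ chart.target
  smooth : ContMDiffOn (𝓡∂ 2) (𝓡 2) ∞ chart chart.source
  smooth_symm : ContMDiffOn (𝓡 2) (𝓡∂ 2) ∞ chart.symm chart.target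
  interior : ∀ x ∈ chart.source, (𝓡∂ 2).IsInteriorPoint x
  isolated : ∀ q ∈ P, q ∈ chart.source → q = p
  oriented : ∀ x ∈ chart.source,
    0 < ContinuousLinearMap.det (mfderiv (𝓡∂ 2) (𝓡 2) chart x : Plane →L[ℝ] Plane)

/-- A marked surface on the smooth surface with boundary `S`, oriented by its preferred charts:
finitely many punctures in the interior and boundary points on the boundary, at least one marked
point, and at least one marked point on every boundary component.

The last two fields are auxiliary choices of places where the decorations are read off: a small
disk around each puncture and a tangent direction at each boundary point.  The orientation
preserving disks around a puncture form a connected family, and so do the directions at a boundary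
point, so that other choices lead to isomorphic moduli spaces and the same diagram invariants. -/
structure MarkedSurface where
  oriented : ∀ x y z : S, z ∈ (chartAt (EuclideanHalfSpace 2) x).source →
    z ∈ (chartAt (EuclideanHalfSpace 2) y).source →
    0 < ContinuousLinearMap.det (tangentCoordChange (𝓡∂ 2) x y z)
  punctures : Finset S
  boundaryPoints : Finset S
  isInteriorPoint : ∀ p ∈ punctures, (𝓡∂ 2).IsInteriorPoint p
  isBoundaryPoint : ∀ q ∈ boundaryPoints, (𝓡∂ 2).IsBoundaryPoint q
  exists_marked : punctures.Nonempty ∨ boundaryPoints.Nonempty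
  exists_marked_on_component : ∀ x ∈ (𝓡∂ 2).boundary S, ∃ q ∈ boundaryPoints,
    q ∈ connectedComponentIn ((𝓡∂ 2).boundary S) x
  disk : ∀ p : punctures, PuncturedDisk S punctures (p : S)
  direction : ∀ q : boundaryPoints, TangentSpace (𝓡∂ 2) (q : S)
  direction_ne_zero : ∀ q, direction q ≠ 0

namespace MarkedSurface

variable {S} (M : MarkedSurface S)

/-- The space of nonzero tangent vectors of the surface with its punctures removed. -/
def TangentDirections : Type _ :=
  {v : TangentBundle (𝓡∂ 2) S // v.proj ∉ M.punctures ∧ v.snd ≠ 0}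

instance : TopologicalSpace M.TangentDirections :=
  instTopologicalSpaceSubtype

/-- Homotopy classes (with fixed ends) of paths in the space of nonzero tangent vectors of the
punctured surface.  Equivalently, by the theorem of Hirsch and Smale, regular homotopy classes of
immersed arcs with prescribed directions at the two ends. -/
abbrev Arc (a b : M.TangentDirections) : Type _ := Path.Homotopic.Quotient a b

/-- The unit circle in the disk around the puncture `p`, with its velocity vectors. -/
def circleLift (p : M.punctures) (t : ℝ) : TangentBundle (𝓡∂ 2) S :=
  tangentMapWithin (𝓡 2) (𝓡∂ 2) (M.disk p).chart.symm (M.disk p).chart.target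
    ⟨Plane.circle t, Plane.velocity t⟩

theorem circle_mem_target (p : M.punctures) (t : ℝ) :
    Plane.circle t ∈ (M.disk p).chart.target :=
  (M.disk p).closedBall_subset (by simp [Plane.norm_circle])

theorem continuous_circleLift (p : M.punctures) : Continuous (M.circleLift p) := by
  have h := (M.disk p).smooth_symm.continuousOn_tangentMapWithin (by simp)
    (M.disk p).chart.open_target.uniqueMDiffOn
  refine h.comp_continuous (f := fun t : ℝ =>
    (⟨Plane.circle t, Plane.velocity t⟩ : TangentBundle (𝓡 2) Plane)) ?_
    (fun t => M.circle_mem_target p t)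
  have : Continuous fun t : ℝ => (tangentBundleModelSpaceHomeomorph (𝓡 2)).symm
      ((Plane.circle t, Plane.velocity t) : ModelProd Plane Plane) :=
    (tangentBundleModelSpaceHomeomorph (𝓡 2)).symm.continuous.comp
      (Plane.continuous_circle.prodMk Plane.continuous_velocity)
  exact this

theorem circleLift_mem (p : M.punctures) (t : ℝ) :
    (M.circleLift p t).proj ∉ M.punctures ∧ (M.circleLift p t).snd ≠ 0 := by
  have ht := M.circle_mem_target p t
  constructor
  · intro h
    have hs : (M.disk p).chart.symm (Plane.circle t) ∈ (M.disk p).chart.source :=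
      (M.disk p).chart.map_target ht
    have h1 : (M.disk p).chart.symm (Plane.circle t) = p := (M.disk p).isolated _ h hs
    have h2 : Plane.circle t = 0 := by
      rw [← (M.disk p).chart.right_inv ht, h1, (M.disk p).map_centre]
    have := Plane.norm_circle t
    rw [h2, norm_zero] at this
    norm_num at this
  · intro h
    set c := Plane.circle t
    have hopen := (M.disk p).chart.open_target.mem_nhds ht
    have hsymm : MDifferentiableAt (𝓡 2) (𝓡∂ 2) (M.disk p).chart.symm c :=
      ((M.disk p).smooth_symm.contMDiffAt hopen).mdifferentiableAt (by simp)
    have hchart : MDifferentiableAt (𝓡∂ 2) (𝓡 2) (M.disk p).chart ((M.disk p).chart.symm c) :=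
      ((M.disk p).smooth.contMDiffAt ((M.disk p).chart.open_source.mem_nhds
        ((M.disk p).chart.map_target ht))).mdifferentiableAt (by simp)
    have hcomp := mfderiv_comp c hchart hsymm
    have hid : (M.disk p).chart ∘ (M.disk p).chart.symm =ᶠ[nhds c] id := by
      filter_upwards [hopen] with y hy using (M.disk p).chart.right_inv hy
    rw [hid.mfderiv_eq, mfderiv_id] at hcomp
    have h' : mfderiv (𝓡 2) (𝓡∂ 2) (M.disk p).chart.symm c (Plane.velocity t) = 0 := by
      rw [← mfderivWithin_of_mem_nhds hopen]
      exact h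
    have := DFunLike.congr_fun hcomp (Plane.velocity t)
    refine Plane.velocity_ne_zero t (this.trans ?_)
    exact (congrArg (mfderiv (𝓡∂ 2) (𝓡 2) (M.disk p).chart _) h').trans
      (ContinuousLinearMap.map_zero _)

/-- The base point of the puncture `p`: the point `1` of the circle around `p`, with its velocity
vector. -/
def punctureBase (p : M.punctures) : M.TangentDirections :=
  ⟨M.circleLift p 0, M.circleLift_mem p 0⟩

/-- The loop given by the counterclockwise simple closed curve around the puncture `p` together
with its velocity vectors. -/
def punctureLoop (p : M.punctures) : Path (M.punctureBase p) (M.punctureBase p) where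
  toFun t := ⟨M.circleLift p t, M.circleLift_mem p t⟩
  continuous_toFun :=
    Continuous.subtype_mk ((M.continuous_circleLift p).comp continuous_subtype_val) _
  source' := rfl
  target' := by
    apply Subtype.ext
    change M.circleLift p 1 = M.circleLift p 0
    unfold circleLift
    rw [Plane.circle_one, Plane.velocity_one]

/-- The base point of a boundary point: the point itself, with the chosen direction. -/
def boundaryBase (q : M.boundaryPoints) : M.TangentDirections :=
  ⟨⟨q, M.direction q⟩, fun h =>
    ((𝓡∂ 2).isInteriorPoint_iff_not_isBoundaryPoint _).1 (M.isInteriorPoint _ h)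
      (M.isBoundaryPoint _ q.2), M.direction_ne_zero q⟩

end MarkedSurface

/-! ### Exterior algebra and affine flags -/

/-- The vector space `ℂ ^ k`. -/
abbrev Vec (k : ℕ) : Type := Fin k → ℂ

/-- The exterior algebra of `ℂ ^ k`. -/
abbrev ExtAlg (k : ℕ) : Type := ExteriorAlgebra ℂ (Vec k)

/-- The group `SL_k(ℂ)`. -/
abbrev SLk (k : ℕ) : Type := Matrix.SpecialLinearGroup (Fin k) ℂ

namespace ExtAlg

variable {k : ℕ}

/-- The basis of the exterior algebra consisting of the increasing exterior products
`e_I = e_{i₁} ∧ ⋯ ∧ e_{iₐ}` of standard basis vectors, for `I = {i₁ < ⋯ < iₐ}`. -/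
def stdBasis (k : ℕ) : Module.Basis (Finset (Fin k)) ℂ (ExtAlg k) :=
  (Pi.basisFun ℂ (Fin k)).ExteriorAlgebra

/-- The coefficient of `e_I` in `x`. -/
def coeff (I : Finset (Fin k)) (x : ExtAlg k) : ℂ := (stdBasis k).repr x I

/-- The vector `v` as an element of the exterior algebra. -/
abbrev vec (v : Vec k) : ExtAlg k := ExteriorAlgebra.ι ℂ v

/-- The volume form `e_1 ∧ ⋯ ∧ e_k`. -/
def volumeForm (k : ℕ) : ExtAlg k := stdBasis k Finset.univ

/-- The action of `SL_k` on the exterior algebra. -/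
def act (g : SLk k) : ExtAlg k →ₐ[ℂ] ExtAlg k := ExteriorAlgebra.map (Matrix.toLin' g.1)

end ExtAlg

/-- An affine flag for `SL_k`: tensors `F_(i) ∈ ⋀^i V`, where `F_(k)` is the volume form and
`F_(i+1) = F_(i) ∧ v` for some vector `v`.  We put `F_(0) = 1`; the steps beyond `k` vanish. -/
@[ext] structure AffineFlag (k : ℕ) where
  step : ℕ → ExtAlg k
  step_mem : ∀ i, step i ∈ (⋀[ℂ]^i (Vec k) : Submodule ℂ (ExtAlg k))
  step_zero : step 0 = 1
  step_top : step k = ExtAlg.volumeForm k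
  flag : ∀ i, i < k → ∃ v : Vec k, step i * ExtAlg.vec v = step (i + 1)

/-- The matrix `u` stabilizes the affine flag `F`. -/
def AffineFlag.IsStabilizedBy {k : ℕ} (F : AffineFlag k) (u : SLk k) : Prop :=
  ∀ i, ExtAlg.act u (F.step i) = F.step i

/-- `F' = s_{i+1} · F` for the Weyl group action determined by `u` (here `0 ≤ i` and `i + 1 < k`):
if `F_(i+2) = F_(i+1) ∧ v`, then `F'_(i+1) = F_(i) ∧ (u v - v)`, and the other steps agree.
As `F'` is required to be an affine flag, there is no such `F'` if `u v - v` lies in the span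
of `F_(i)`. -/
def IsSimpleReflection {k : ℕ} (u : SLk k) (i : ℕ) (F F' : AffineFlag k) : Prop :=
  (∃ v : Vec k, F.step (i + 2) = F.step (i + 1) * ExtAlg.vec v ∧
    F'.step (i + 1) = F.step i * ExtAlg.vec (u.1.mulVec v - v)) ∧
  ∀ j, j ≠ i + 1 → F'.step j = F.step j

/-- `IsWeylTranslate u F w F'` means that `F' = w · F` for the (partially defined) Weyl group
action determined by `u`: there is a word `s_{i₁} s_{i₂} ⋯ s_{iᵣ}` for the permutation `w`
such that `F'` is obtained from `F` by applying first `s_{i₁}`, then `s_{i₂}`, and so on.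
(In one-line notation, multiplication of `w` by `s_i` from the right interchanges the symbols
in the adjacent positions `i` and `i + 1`.) -/
inductive IsWeylTranslate {k : ℕ} (u : SLk k) (F : AffineFlag k) :
    Equiv.Perm (Fin k) → AffineFlag k → Prop
  | refl : IsWeylTranslate u F 1 F
  | step {w : Equiv.Perm (Fin k)} {F' F'' : AffineFlag k} (i : ℕ) (hi : i + 1 < k) :
      IsWeylTranslate u F w F' → IsSimpleReflection u i F' F'' →
      IsWeylTranslate u F (w * Equiv.swap ⟨i, Nat.lt_of_succ_lt hi⟩ ⟨i + 1, hi⟩) F''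

/-- All simple reflections `s_i · F` are defined, equivalently, the whole Weyl group orbit of the
affine flag `F` is defined. -/
def AffineFlag.IsGeneric {k : ℕ} (F : AffineFlag k) (u : SLk k) : Prop :=
  ∀ i, i + 1 < k → ∃ F', IsSimpleReflection u i F F'

/-- `t = (w · F)_(a)` for a permutation `w` with `w ([a]) = A`, where `a = |A|`. -/
def IsLegTensor {k : ℕ} (u : SLk k) (F : AffineFlag k) (A : Finset (Fin k)) (t : ExtAlg k) : Prop :=
  ∃ (w : Equiv.Perm (Fin k)) (F' : AffineFlag k), IsWeylTranslate u F w F' ∧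
    (∀ j : Fin k, w j ∈ A ↔ (j : ℕ) < A.card) ∧ F'.step A.card = t

open Classical in
/-- The tensor `(w · F)_(a) ∈ ⋀^a V`, where `a = |A|` and `w` is an arbitrarily chosen permutation
with `w ([a]) = A`. -/
def legTensor {k : ℕ} (u : SLk k) (F : AffineFlag k) (A : Finset (Fin k)) : ExtAlg k :=
  if h : ∃ t, IsLegTensor u F A t then h.choose else 0

/-! ### Decorated local systems -/

/-- The two versions of the moduli space: boundary points are decorated by affine flags
(Fock–Goncharov version) or by vectors (Grassmannian version). -/
inductive Flavor
  | fockGoncharov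
  | grassmannian

/-- The decorations of a boundary point. -/
def BoundaryDecoration (k : ℕ) : Flavor → Type
  | .fockGoncharov => AffineFlag k
  | .grassmannian => Vec k

/-- The tensor which a decoration of a boundary point assigns to an edge of weight `a`.
(In the Grassmannian version only `a = 1` occurs.) -/
def BoundaryDecoration.tensor {k : ℕ} : {c : Flavor} → BoundaryDecoration k c → ℕ → ExtAlg k
  | .fockGoncharov, F, a => AffineFlag.step (show AffineFlag k from F) a
  | .grassmannian, v, _ => ExtAlg.vec (show Vec k from v)

namespace MarkedSurface

variable {S} (M : MarkedSurface S)

/-- A twisted decorated `SL_k`-local system on the marked surface `M`, each fibre being a copy of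
`ℂ ^ k`: transport isomorphisms along paths of nonzero tangent vectors of the punctured surface,
where turning a tangent vector around once gives `(-1)^(k-1)` (so that, for odd `k`, this is just a
local system on the punctured surface); an affine flag at each puncture, stabilized by the monodromy
around the puncture; and an affine flag or a vector at each boundary point. -/
structure DecoratedLocalSystem (k : ℕ) (c : Flavor) where
  transport : ∀ {a b : M.TangentDirections}, M.Arc a b → SLk k
  transport_refl : ∀ a, transport (Path.Homotopic.Quotient.refl a) = 1
  transport_trans : ∀ {a b d : M.TangentDirections} (γ : M.Arc a b) (δ : M.Arc b d),
    transport (γ.trans δ) = transport δ * transport γ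
  transport_turn : ∀ (x : S) (v w : TangentSpace (𝓡∂ 2) x) (a : M.TangentDirections)
    (γ : Path a a), LinearIndependent ℝ ![v, w] →
    (∀ t, (γ t).1 = ⟨x, Real.cos (2 * Real.pi * t) • v + Real.sin (2 * Real.pi * t) • w⟩) →
    (transport (Path.Homotopic.Quotient.mk γ) : Matrix (Fin k) (Fin k) ℂ) = (-1) ^ (k - 1)
  flag : M.punctures → AffineFlag k
  flag_stabilized : ∀ p, (flag p).IsStabilizedBy
    (transport (Path.Homotopic.Quotient.mk (M.punctureLoop p)))
  decoration : M.boundaryPoints → BoundaryDecoration k c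

/-- The monodromy around the puncture `p`. -/
def DecoratedLocalSystem.monodromy {M : MarkedSurface S} {k : ℕ} {c : Flavor}
    (z : M.DecoratedLocalSystem k c) (p : M.punctures) : SLk k :=
  z.transport (Path.Homotopic.Quotient.mk (M.punctureLoop p))

/-- The decorated local systems at which the Weyl group actions at all punctures are defined.
They form the domain on which we consider rational functions: the dense open part of the moduli
space where all pseudotagged diagram invariants are regular.  A function on the moduli space is
viewed as a function of decorated local systems (which takes the same value on isomorphic ones). -/
def GenericPoint (k : ℕ) (c : Flavor) : Type _ :=
  {z : M.DecoratedLocalSystem k c // ∀ p, (z.flag p).IsGeneric (z.monodromy p)}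

end MarkedSurface

/-! ### Tensor diagrams -/

/-- The four kinds of vertices which are not marked points. -/
inductive VertexKind
  | wedge
  | dualWedge
  | coevaluation
  | evaluation

/-- The condition on the weights of incoming and outgoing edges at a vertex of each kind. -/
def VertexKind.Admissible (k : ℕ) : VertexKind → List ℕ → List ℕ → Prop
  | .wedge, ins, outs => outs = [ins.sum]
  | .dualWedge, ins, outs => ins = [outs.sum]
  | .coevaluation, ins, outs => ins = [] ∧ outs = [k]
  | .evaluation, ins, outs => ins = [k] ∧ outs = []

/-- The matrix coefficients, in the bases `e_I`, of the morphisms encoded by the vertices: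
for `[I₁, …, Iₘ]` on the incoming and `[K₁, …, Kₙ]` on the outgoing edges, this is the coefficient
of `e_{K₁} ⊗ ⋯ ⊗ e_{Kₙ}` in the image of `e_{I₁} ⊗ ⋯ ⊗ e_{Iₘ}`.
* An exterior product vertex encodes the exterior product.
* A dual exterior product vertex encodes `e_I ↦ ∑ ± e_{K₁} ⊗ ⋯ ⊗ e_{Kₙ}`, the sum over all ordered
  set partitions of `I` into blocks of the prescribed sizes; the sign is the one with
  `e_I = ± e_{Kₙ} ∧ ⋯ ∧ e_{K₁}`.
* A coevaluation leaf encodes `1 ↦ e_1 ∧ ⋯ ∧ e_k` and an evaluation leaf the inverse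
  isomorphism. -/
def VertexKind.coeff {k : ℕ} :
    VertexKind → List (Finset (Fin k)) → List (Finset (Fin k)) → ℂ
  | .wedge, ins, [K] => ExtAlg.coeff K (ins.map (ExtAlg.stdBasis k)).prod
  | .dualWedge, [I], outs => ExtAlg.coeff I (outs.reverse.map (ExtAlg.stdBasis k)).prod
  | .coevaluation, [], [K] => ExtAlg.coeff K (ExtAlg.volumeForm k)
  | .evaluation, [I], [] => ExtAlg.coeff Finset.univ (ExtAlg.stdBasis k I)
  | _, _, _ => 0

namespace MarkedSurface

variable {S}

/-- The vertices of a tensor diagram: the marked points and the vertices in the interior. -/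
inductive Vertex (M : MarkedSurface S) (V : Type) : Type _
  | inner (v : V)
  | puncture (p : M.punctures)
  | boundary (q : M.boundaryPoints)

/-- The location of a vertex. -/
def Vertex.location {M : MarkedSurface S} {V : Type} (pos : V → M.TangentDirections) :
    M.Vertex V → M.TangentDirections
  | .inner v => pos v
  | .puncture p => M.punctureBase p
  | .boundary q => M.boundaryBase q

/-- Tensor diagrams: finite acyclic directed graphs immersed in the surface, with edges weighted by
elements of `{1, …, k}`, whose marked points are sources and whose other vertices are of the four
kinds above.  As diagrams are considered up to isotopy, with crossings allowed, an immersed edge is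
recorded by the class of its lift to the space of tangent directions.  All edges pass through a
vertex `v` in the direction `pos v`, so that the edges entering (and those leaving) are arranged
from left to right. -/
structure TensorDiagram (M : MarkedSurface S) (k : ℕ) (c : Flavor) where
  /-- The vertices which are not marked points. -/
  V : Type
  /-- The edges. -/
  E : Type
  [fintypeV : Fintype V]
  [fintypeE : Fintype E]
  [decidableEqE : DecidableEq E]
  kind : V → VertexKind
  pos : V → M.TangentDirections
  pos_interior : ∀ v, (𝓡∂ 2).IsInteriorPoint (pos v).1.proj
  src : E → M.Vertex V
  tgt : E → V
  arc : ∀ e, M.Arc ((src e).location pos) (pos (tgt e))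
  wt : E → ℕ
  one_le_wt : ∀ e, 1 ≤ wt e
  wt_le : ∀ e, wt e ≤ k
  /-- In the Grassmannian version, edges at boundary points have weight one. -/
  wt_boundary : c = Flavor.grassmannian → ∀ e q, src e = Vertex.boundary q → wt e = 1
  /-- The incoming edges at a vertex, from left to right. -/
  inEdges : V → List E
  /-- The outgoing edges at a vertex, from left to right. -/
  outEdges : V → List E
  nodup_inEdges : ∀ v, (inEdges v).Nodup
  nodup_outEdges : ∀ v, (outEdges v).Nodup
  mem_inEdges : ∀ v e, e ∈ inEdges v ↔ tgt e = v
  mem_outEdges : ∀ v e, e ∈ outEdges v ↔ src e = Vertex.inner v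
  admissible : ∀ v, (kind v).Admissible k ((inEdges v).map wt) ((outEdges v).map wt)
  acyclic : ∀ v, ¬ Relation.TransGen (fun x y => ∃ e, src e = Vertex.inner x ∧ tgt e = y) v v

attribute [instance] TensorDiagram.fintypeV TensorDiagram.fintypeE TensorDiagram.decidableEqE

namespace TensorDiagram

variable {M : MarkedSurface S} {k : ℕ} {c : Flavor} (T : M.TensorDiagram k c)

/-- The legs of a tensor diagram: its edges at punctures. -/
def Leg : Type := {e : T.E // ∃ p, T.src e = Vertex.puncture p}

/-- A pseudotagging: a set `φ(e) ⊆ [k]` with `wt(e)` elements for each leg `e`. -/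
structure Pseudotagging where
  tag : T.Leg → Finset (Fin k)
  card_tag : ∀ e, (tag e).card = T.wt e.1

variable {T}

/-- A pseudotagging is a tagging if the sets at any two legs at the same puncture are
comparable. -/
def Pseudotagging.IsTagging (φ : T.Pseudotagging) : Prop :=
  ∀ (p : M.punctures) (e e' : T.Leg), T.src e.1 = Vertex.puncture p →
    T.src e'.1 = Vertex.puncture p → φ.tag e ⊆ φ.tag e' ∨ φ.tag e' ⊆ φ.tag e

/-- The coefficient of `e_I` in the tensor assigned to the edge `e` at its source, if this is a
marked point, and `1` otherwise. -/
def sourceCoeff (φ : T.Pseudotagging) (z : M.DecoratedLocalSystem k c) (e : T.E)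
    (I : Finset (Fin k)) : ℂ :=
  match h : T.src e with
  | .inner _ => 1
  | .puncture p => ExtAlg.coeff I (legTensor (z.monodromy p) (z.flag p) (φ.tag ⟨e, p, h⟩))
  | .boundary q => ExtAlg.coeff I ((z.decoration q).tensor (T.wt e))

/-- The value at `z` of the invariant of a pseudotagged tensor diagram: the image of the tensor
product of the tensors at the marked points and at the coevaluation leaves under the composition of
the transport isomorphisms and the morphisms encoded by the vertices.  The composition is computed
in the bases `e_I` of the exterior powers `⋀^wt(e) V`: we sum over the basis elements `I e` at the
beginning and `J e` at the end of each edge `e`. -/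
def value (φ : T.Pseudotagging) (z : M.DecoratedLocalSystem k c) : ℂ :=
  ∑ I ∈ Fintype.piFinset fun e => Finset.powersetCard (T.wt e) (Finset.univ : Finset (Fin k)),
  ∑ J ∈ Fintype.piFinset fun e => Finset.powersetCard (T.wt e) (Finset.univ : Finset (Fin k)),
    (∏ e, sourceCoeff φ z e (I e)) *
    (∏ e, ExtAlg.coeff (J e) (ExtAlg.act (z.transport (T.arc e)) (ExtAlg.stdBasis k (I e)))) *
    (∏ v, (T.kind v).coeff ((T.inEdges v).map J) ((T.outEdges v).map I))

/-- The invariant of a pseudotagged tensor diagram, as a function on the generic part of the moduli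
space. -/
def invariant (φ : T.Pseudotagging) (z : M.GenericPoint k c) : ℂ := value φ z.1

end TensorDiagram

variable (M : MarkedSurface S) (k : ℕ) (c : Flavor)

/-- The set of pseudotagged diagram invariants. -/
def pseudotaggedInvariants : Set (M.GenericPoint k c → ℂ) :=
  {f | ∃ (T : M.TensorDiagram k c) (φ : T.Pseudotagging), f = TensorDiagram.invariant φ}

/-- The set of tagged diagram invariants. -/
def taggedInvariants : Set (M.GenericPoint k c → ℂ) :=
  {f | ∃ (T : M.TensorDiagram k c) (φ : T.Pseudotagging),
    φ.IsTagging ∧ f = TensorDiagram.invariant φ}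

/-- The algebra generated over `R` by the pseudotagged diagram invariants. -/
def taggedSkeinAlgebra (R : Type) [CommSemiring R] [Algebra R ℂ] :
    Subalgebra R (M.GenericPoint k c → ℂ) :=
  Algebra.adjoin R (M.pseudotaggedInvariants k c)

end MarkedSurface

end

/-! Write `N = u - 1` for the monodromy `u` at a puncture. Since `u` fixes the tensors of the flag,
`N` lowers the flag by one step, and genericity says that no coefficient just below the diagonal is
lost. Iterating `N` on a top vector therefore gives a Jordan basis `y_0, …, y_{k-1}` with `N y_{l+1}
= y_l` and `N y_0 = 0`, in which every step of the flag is `F_(j) = z_0 ⋯ z_{j-1} y_0 ∧ ⋯ ∧ y_{j-1}`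
with nonzero scalars (`IsGeneric.exists_jordanFrame`). A simple reflection interchanges two adjacent
`z_i`, so the tensor at a leg tagged by `A` is `(∏_{i ∈ A} z_i) y_0 ∧ ⋯ ∧ y_{|A|-1}`
(`HasScales.legTensor_eq`).

Let two legs be tagged by `A` and `B`, with `i ∈ A`, `i ∉ B` and `a = |A| ≤ b + 1 = |B| + 1`. Moving
`i` from `A` to `B` preserves the product of all scalars. Split a vector off `y_0 ∧ ⋯ ∧ y_b`, apply
`N^(b+1-a)`, and multiply it onto `y_0 ∧ ⋯ ∧ y_{a-2}`: only the vector `y_b` survives, and it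
becomes `y_{a-1}`. This recovers the original pair of tensors (`IsJordanFrame.exchange`). By the
binomial theorem the power of `N` is an integral combination of powers `u^j`, and `u^j` is drawn as
an edge winding `j` times around the puncture. Hence `ExchangeSite.value_eq_sum` writes an invariant
as an integral combination of invariants in which the two legs have tags `A \ {i}` and `B ∪ {i}`.

Incomparable tags always allow such a move from the leg of smaller or equal weight, and the move
spreads the weights apart. The sum of `k² - a²` over all legs drops (`ExchangeSite.legMeasure_lt`),
so the process ends at taggings. Superposition of diagrams multiplies invariants (`value_union`),
which yields the statements about algebras. -/

noncomputable section

/-! ### Coefficients, contractions and decomposable tensors in the exterior algebra -/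

namespace ExtAlg

variable {k : ℕ}

/-- The standard basis vectors. -/
abbrev e (i : Fin k) : Vec k := Pi.single i 1

theorem coeff_eq_zero_of_mem {n : ℕ} {t : ExtAlg k}
    (ht : t ∈ (⋀[ℂ]^n (Vec k) : Submodule ℂ (ExtAlg k))) {I : Finset (Fin k)} (hI : I.card ≠ n) :
    coeff I t = 0 := by
  have h := ((Pi.basisFun ℂ (Fin k)).exteriorPower n).sum_repr ⟨t, ht⟩
  have h2 := congrArg (Submodule.subtype _) h
  rw [map_sum] at h2
  simp only [map_smul, Submodule.subtype_apply, ← ExteriorAlgebra.basis_eq_coe_basis] at h2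
  unfold coeff stdBasis
  rw [← h2, map_sum, Finsupp.finsetSum_apply]
  refine Finset.sum_eq_zero fun J _ => ?_
  rw [map_smul, Module.Basis.repr_self, Finsupp.smul_apply, Finsupp.single_eq_of_ne, smul_zero]
  rintro rfl
  exact hI J.2

theorem sum_coeff_powersetCard {n : ℕ} {t : ExtAlg k}
    (ht : t ∈ (⋀[ℂ]^n (Vec k) : Submodule ℂ (ExtAlg k))) :
    ∑ I ∈ Finset.powersetCard n Finset.univ, coeff I t • stdBasis k I = t := by
  conv_rhs => rw [← (stdBasis k).sum_repr t]
  refine Finset.sum_subset (Finset.subset_univ _) fun I _ hI => ?_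
  rw [coeff_eq_zero_of_mem ht, zero_smul]
  simpa using hI

theorem coeff_stdBasis (I J : Finset (Fin k)) :
    coeff I (stdBasis k J) = if J = I then 1 else 0 := by
  simp [coeff, Finsupp.single_apply]

theorem coeff_smul (I : Finset (Fin k)) (r : ℂ) (t : ExtAlg k) :
    coeff I (r • t) = r * coeff I t := by
  simp [coeff]

/-- The coefficient of `e_I` as a linear form. -/
def coeffₗ (I : Finset (Fin k)) : ExtAlg k →ₗ[ℂ] ℂ := (stdBasis k).coord I

theorem coeffₗ_apply (I : Finset (Fin k)) (t : ExtAlg k) : coeffₗ I t = coeff I t := rfl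

theorem stdBasis_singleton (i : Fin k) : stdBasis k {i} = vec (e i) := by
  unfold stdBasis
  rw [ExteriorAlgebra.basis_apply_ofCard (n := 1) _ (Finset.card_singleton i)]
  simp only [ExteriorAlgebra.ιMulti_family]
  rw [ExteriorAlgebra.ιMulti_apply]
  have h := (Set.powersetCard.mem_range_ofFinEmbEquiv_symm_iff_mem
    (Set.powersetCard.ofCard (Finset.card_singleton i)) _).1 ⟨0, rfl⟩
  have h2 : Set.powersetCard.ofFinEmbEquiv.symm
    (Set.powersetCard.ofCard (Finset.card_singleton i)) 0 = i := Finset.mem_singleton.1 h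
  simp [h2]

theorem stdBasis_empty : stdBasis k ∅ = 1 := by
  unfold stdBasis
  rw [ExteriorAlgebra.basis_apply_ofCard (n := 0) _ Finset.card_empty]
  simp [ExteriorAlgebra.ιMulti_family]

theorem stdBasis_mul_vec_of_mem {K : Finset (Fin k)} {i : Fin k} (h : i ∈ K) :
    stdBasis k K * vec (e i) = 0 := by
  rw [← stdBasis_singleton]
  exact ExteriorAlgebra.basis_mul_of_not_disjoint (Pi.basisFun ℂ (Fin k))
    (⟨K, rfl⟩ : Set.powersetCard (Fin k) K.card) (⟨{i}, Finset.card_singleton i⟩ :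
      Set.powersetCard (Fin k) 1) (by simpa using h)

theorem exists_stdBasis_mul_vec {K : Finset (Fin k)} {i : Fin k} (h : i ∉ K) :
    ∃ ε : ℂ, ε * ε = 1 ∧ stdBasis k K * vec (e i) = ε • stdBasis k (insert i K) := by
  rw [← stdBasis_singleton]
  have hd : Disjoint (⟨K, rfl⟩ : Set.powersetCard (Fin k) K.card).val
    (⟨{i}, Finset.card_singleton i⟩ : Set.powersetCard (Fin k) 1).val := by simpa using h
  have := ExteriorAlgebra.basis_mul_of_disjoint (Pi.basisFun ℂ (Fin k)) _ _ hd
  refine ⟨((Set.powersetCard.permOfDisjoint hd).sign : ℤ), ?_, ?_⟩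
  · rcases Int.units_eq_one_or (Set.powersetCard.permOfDisjoint hd).sign with h | h <;> simp [h]
  · unfold stdBasis
    refine this.trans ?_
    have h2 : ((Set.powersetCard.disjUnion hd : Set.powersetCard (Fin k) (K.card + 1)) :
        Finset (Fin k)) = insert i K := by
      ext j
      simp
    rw [h2]
    rcases Int.units_eq_one_or (Set.powersetCard.permOfDisjoint hd).sign with h | h <;> simp [h]

/-- Contraction with a linear form from the right. -/
def contract (φ : Module.Dual ℂ (Vec k)) : ExtAlg k →ₗ[ℂ] ExtAlg k :=
  (CliffordAlgebra.contractRight (Q := (0 : QuadraticForm ℂ (Vec k)))).flip φ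

theorem contract_mul_vec (φ : Module.Dual ℂ (Vec k)) (t : ExtAlg k) (v : Vec k) :
    contract φ (t * vec v) = φ v • t - contract φ t * vec v :=
  CliffordAlgebra.contractRight_mul_ι _ _ _

theorem contract_one (φ : Module.Dual ℂ (Vec k)) : contract φ (1 : ExtAlg k) = 0 :=
  CliffordAlgebra.contractRight_one (Q := (0 : QuadraticForm ℂ (Vec k))) φ

theorem contract_proj_stdBasis_of_notMem {K : Finset (Fin k)} {i : Fin k} (h : i ∉ K) :
    contract (LinearMap.proj i) (stdBasis k K) = 0 := by
  induction K using Finset.induction_on with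
  | empty => rw [stdBasis_empty, contract_one]
  | insert j K hj ih =>
    simp only [Finset.mem_insert, not_or] at h
    obtain ⟨ε, hε, h2⟩ := exists_stdBasis_mul_vec hj
    have : stdBasis k (insert j K) = ε • (stdBasis k K * vec (e j)) := by
      rw [h2, smul_smul, hε, one_smul]
    rw [this, map_smul, contract_mul_vec, ih h.2]
    simp [h.1]

/-- Contraction with the `i`th coordinate and right multiplication by `e_i` have transposed matrices
in the basis `e_I`. This is how a dual exterior product vertex, whose coefficients are those of a
product, comes to act as a contraction. -/
theorem coeff_contract_proj_stdBasis (I K : Finset (Fin k)) (i : Fin k) :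
    coeff K (contract (LinearMap.proj i) (stdBasis k I)) = coeff I (stdBasis k K * vec (e i)) := by
  by_cases hI : i ∈ I
  · obtain ⟨ε, hε, h2⟩ := exists_stdBasis_mul_vec (Finset.notMem_erase i I)
    rw [Finset.insert_erase hI] at h2
    have : stdBasis k I = ε • (stdBasis k (I.erase i) * vec (e i)) := by
      rw [h2, smul_smul, hε, one_smul]
    rw [this, map_smul, contract_mul_vec,
      contract_proj_stdBasis_of_notMem (Finset.notMem_erase i I)]
    simp only [LinearMap.proj_apply, Pi.single_eq_same, one_smul, zero_mul, sub_zero, coeff_smul,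
      coeff_stdBasis]
    by_cases hK : i ∈ K
    · rw [stdBasis_mul_vec_of_mem hK, if_neg]
      · simp [coeff]
      · rintro rfl
        exact Finset.notMem_erase i I hK
    · by_cases hIK : I.erase i = K
      · subst hIK
        rw [h2, coeff_smul, coeff_stdBasis]
        simp
      · obtain ⟨δ, -, h3⟩ := exists_stdBasis_mul_vec hK
        rw [h3, coeff_smul, coeff_stdBasis, if_neg hIK, if_neg]
        · simp
        · rintro rfl
          exact hIK (Finset.erase_insert hK)
  · rw [contract_proj_stdBasis_of_notMem hI]
    by_cases hK : i ∈ K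
    · rw [stdBasis_mul_vec_of_mem hK]
      simp [coeff]
    · obtain ⟨δ, -, h3⟩ := exists_stdBasis_mul_vec hK
      rw [h3, coeff_smul, coeff_stdBasis, if_neg]
      · simp [coeff]
      · rintro rfl
        exact hI (Finset.mem_insert_self i K)

/-- Contraction with `φ` is adjoint to the exterior multiplication by `∑ φ(e_i) e_i`. -/
theorem sum_coeff_mul_vec (X : ExtAlg k) (K : Finset (Fin k)) (φ : Module.Dual ℂ (Vec k)) :
    ∑ i, (∑ I, coeff I X * coeff I (stdBasis k K * vec (e i))) * φ (e i) =
      coeff K (contract φ X) := by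
  have hφ : φ = ∑ i, φ (e i) • (LinearMap.proj i : Module.Dual ℂ (Vec k)) := by
    refine (Pi.basisFun ℂ (Fin k)).ext fun j => ?_
    simp [LinearMap.sum_apply, Pi.single_apply]
  have hX : coeff K (contract φ X) = ∑ I, coeff I X * coeff K (contract φ (stdBasis k I)) := by
    conv_lhs => rw [← (stdBasis k).sum_repr X, map_sum, ← coeffₗ_apply, map_sum]
    simp only [map_smul, coeffₗ_apply, smul_eq_mul]
    rfl
  have hI (I : Finset (Fin k)) : coeff K (contract φ (stdBasis k I)) =
      ∑ i, φ (e i) * coeff I (stdBasis k K * vec (e i)) := by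
    simp only [← coeff_contract_proj_stdBasis]
    conv_lhs => rw [hφ]
    unfold contract
    rw [map_sum, LinearMap.sum_apply, ← coeffₗ_apply, map_sum]
    simp only [map_smul, LinearMap.smul_apply, coeffₗ_apply, smul_eq_mul]
  rw [hX]
  simp only [hI, Finset.mul_sum, Finset.sum_mul]
  rw [Finset.sum_comm]
  refine Finset.sum_congr rfl fun I _ => Finset.sum_congr rfl fun i _ => ?_
  ring

/-- The exterior product `y_0 ∧ ⋯ ∧ y_{j-1}`. -/
def wedgePrefix (y : ℕ → Vec k) : ℕ → ExtAlg k
  | 0 => 1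
  | j + 1 => wedgePrefix y j * vec (y j)

theorem contract_wedgePrefix {y : ℕ → Vec k} {φ : Module.Dual ℂ (Vec k)} {j : ℕ}
    (h : ∀ l < j, φ (y l) = 0) : contract φ (wedgePrefix y j) = 0 := by
  induction j with
  | zero => exact contract_one _
  | succ j ih =>
    rw [wedgePrefix, contract_mul_vec, ih fun l hl => h l (by omega), h j (by omega)]
    simp

/-- Otherwise some linear form kills all `y_l` with `l < j` but not `w`. Contracting the vanishing
product with it returns a nonzero multiple of `y_0 ∧ ⋯ ∧ y_{j-1}`. -/
theorem mem_span_of_wedgePrefix_mul_eq_zero {y : ℕ → Vec k} {j : ℕ} {w : Vec k}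
    (hY : wedgePrefix y j ≠ 0) (h : wedgePrefix y j * vec w = 0) :
    w ∈ Submodule.span ℂ (y '' Set.Iio j) := by
  by_contra hw
  obtain ⟨φ, hφ, hle⟩ := Submodule.exists_le_ker_of_notMem hw
  have h2 := contract_mul_vec φ (wedgePrefix y j) w
  rw [h, map_zero, contract_wedgePrefix fun l hl =>
    hle (Submodule.subset_span ⟨l, hl, rfl⟩), zero_mul, sub_zero] at h2
  exact (smul_ne_zero hφ hY) h2.symm

theorem wedgePrefix_mul_vec_of_mem_span {y : ℕ → Vec k} {j : ℕ} {w : Vec k}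
    (hw : w ∈ Submodule.span ℂ (y '' Set.Iio j)) : wedgePrefix y j * vec w = 0 := by
  have key : ∀ j, ∀ l < j, wedgePrefix y j * vec (y l) = 0 := by
    intro j
    induction j with
    | zero => intro l hl; omega
    | succ j ih =>
      intro l hl
      rw [wedgePrefix, mul_assoc]
      obtain rfl | hlj : l = j ∨ l < j := by omega
      · rw [vec, ExteriorAlgebra.ι_sq_zero, mul_zero]
      · rw [eq_neg_of_add_eq_zero_left (ExteriorAlgebra.ι_add_mul_swap (y j) (y l)), mul_neg,
          ← mul_assoc, ih l hlj, zero_mul, neg_zero]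
  induction hw using Submodule.span_induction with
  | mem v hv => obtain ⟨l, hl, rfl⟩ := hv; exact key j l hl
  | zero => simp
  | add v w _ _ hv hw => rw [vec, map_add, mul_add, hv, hw, add_zero]
  | smul r v _ hv => rw [vec, map_smul, mul_smul_comm, hv, smul_zero]

theorem wedgePrefix_mem (y : ℕ → Vec k) (j : ℕ) :
    wedgePrefix y j ∈ (⋀[ℂ]^j (Vec k) : Submodule ℂ (ExtAlg k)) := by
  induction j with
  | zero => simp [wedgePrefix, ExteriorAlgebra.exteriorPower]
  | succ j ih =>
    rw [wedgePrefix, ExteriorAlgebra.exteriorPower, pow_succ]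
    exact Submodule.mul_mem_mul ih ⟨_, rfl⟩

theorem vec_smul (r : ℂ) (v : Vec k) : vec (r • v) = r • vec v := map_smul _ _ _

theorem act_vec (g : SLk k) (v : Vec k) : act g (vec v) = vec (g.1.mulVec v) := by
  simp [act, Matrix.toLin'_apply]

theorem act_one (t : ExtAlg k) : act (1 : SLk k) t = t := by
  simp [act]

theorem volumeForm_ne_zero : volumeForm k ≠ 0 := (stdBasis k).ne_zero _

end ExtAlg
end

/-! ### Jordan bases of the monodromy -/

noncomputable section

open ExtAlg

variable {k : ℕ}

/-- The endomorphism `u - 1`. -/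
def subOne (u : SLk k) : Module.End ℂ (Vec k) := Matrix.toLin' u.1 - 1

theorem subOne_apply (u : SLk k) (v : Vec k) : subOne u v = u.1.mulVec v - v := by
  simp [subOne, Matrix.toLin'_apply]

/-- The binomial theorem, for `u` and the scalar `-1`. It trades powers of `N`, which have no
picture, for powers of `u`, which are windings around the puncture. -/
theorem subOne_pow_apply (u : SLk k) (s : ℕ) (v : Vec k) :
    (subOne u ^ s) v =
      ∑ j ∈ Finset.range (s + 1), ((-1 : ℂ) ^ (s - j) * s.choose j) • (u ^ j).1.mulVec v := by
  have h : subOne u ^ s = ∑ j ∈ Finset.range (s + 1),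
      ((-1 : ℂ) ^ (s - j) * s.choose j) • Matrix.toLin' (u.1 ^ j) := by
    have h1 : subOne u = Matrix.toLin' u.1 + algebraMap ℂ (Module.End ℂ (Vec k)) (-1) := by
      rw [map_neg, map_one, ← sub_eq_add_neg, subOne]
    have h2 : Commute (Matrix.toLin' u.1) (algebraMap ℂ (Module.End ℂ (Vec k)) (-1)) :=
      (Algebra.commutes _ _).symm
    rw [h1, h2.add_pow s]
    refine Finset.sum_congr rfl fun j _ => ?_
    rw [Matrix.toLin'_pow, ← map_pow (algebraMap ℂ (Module.End ℂ (Vec k))),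
      ← map_natCast (algebraMap ℂ (Module.End ℂ (Vec k))),
      mul_assoc, ← map_mul, Algebra.smul_def, Algebra.commutes]
  rw [h, LinearMap.sum_apply]
  refine Finset.sum_congr rfl fun j _ => ?_
  rw [LinearMap.smul_apply, Matrix.toLin'_apply]
  rfl

/-- `y_0, …, y_{k-1}` is a Jordan basis for the regular unipotent matrix `u`. -/
structure IsJordanFrame (u : SLk k) (y : ℕ → Vec k) : Prop where
  zero : subOne u (y 0) = 0
  succ : ∀ l, l + 1 < k → subOne u (y (l + 1)) = y l
  ne_zero : ∀ j, j ≤ k → wedgePrefix y j ≠ 0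

namespace IsJordanFrame

variable {u : SLk k} {y : ℕ → Vec k}

theorem pow_of_le (h : IsJordanFrame u y) {s l : ℕ} (hl : l < k) (hs : s ≤ l) :
    (subOne u ^ s) (y l) = y (l - s) := by
  induction s with
  | zero => simp
  | succ s ih =>
    rw [pow_succ', Module.End.mul_apply, ih (by omega)]
    have := h.succ (l - (s + 1)) (by omega)
    rwa [show l - (s + 1) + 1 = l - s by omega] at this

theorem pow_of_lt (h : IsJordanFrame u y) {s l : ℕ} (hl : l < k) (hs : l < s) :
    (subOne u ^ s) (y l) = 0 := by
  obtain ⟨d, rfl⟩ := Nat.exists_eq_add_of_lt hs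
  rw [show l + d + 1 = d + (1 + l) by omega, pow_add, pow_add, Module.End.mul_apply,
    Module.End.mul_apply, h.pow_of_le hl le_rfl, Nat.sub_self, pow_one, h.zero, map_zero]

theorem subOne_mem_span (h : IsJordanFrame u y) {j : ℕ} (hj : j < k) {v : Vec k}
    (hv : v ∈ Submodule.span ℂ (y '' Set.Iio (j + 1))) :
    subOne u v ∈ Submodule.span ℂ (y '' Set.Iio j) := by
  induction hv using Submodule.span_induction with
  | mem v hv =>
    obtain ⟨l, hl, rfl⟩ := hv
    rw [Set.mem_Iio] at hl
    cases l with
    | zero => rw [h.zero]; exact zero_mem _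
    | succ l =>
      rw [h.succ l (by omega)]
      exact Submodule.subset_span ⟨l, by simp; omega, rfl⟩
  | zero => rw [map_zero]; exact zero_mem _
  | add v w _ _ hv hw => rw [map_add]; exact add_mem hv hw
  | smul r v _ hv => rw [map_smul]; exact Submodule.smul_mem _ _ hv

/-- The exchange relation between exterior products of a Jordan basis. -/
theorem exchange (h : IsJordanFrame u y) {a b : ℕ} (ha : 1 ≤ a) (hab : a ≤ b + 1) (hb : b < k)
    (K₁ K₂ : Finset (Fin k)) :
    ∑ m, (∑ I, coeff I (wedgePrefix y (b + 1)) * coeff I (stdBasis k K₂ * vec (e m))) *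
      coeff K₁ (wedgePrefix y (a - 1) * vec ((subOne u ^ (b + 1 - a)) (e m))) =
    coeff K₁ (wedgePrefix y a) * coeff K₂ (wedgePrefix y b) := by
  -- With this linear form the left side is a contraction of `y_0 ∧ ⋯ ∧ y_b`, so it suffices to know
  -- `φ` on the `y_l`.
  let φ : Module.Dual ℂ (Vec k) := coeffₗ K₁ ∘ₗ LinearMap.mulLeft ℂ (wedgePrefix y (a - 1)) ∘ₗ
    ExteriorAlgebra.ι ℂ ∘ₗ (subOne u ^ (b + 1 - a))
  have hφ (v : Vec k) :
      φ v = coeff K₁ (wedgePrefix y (a - 1) * vec ((subOne u ^ (b + 1 - a)) v)) := rfl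
  have h1 := sum_coeff_mul_vec (wedgePrefix y (b + 1)) K₂ φ
  simp only [← hφ]
  rw [h1, wedgePrefix, contract_mul_vec, contract_wedgePrefix, zero_mul, sub_zero, coeff_smul, hφ,
    h.pow_of_le hb (by omega), show b - (b + 1 - a) = a - 1 by omega]
  · conv_rhs => rw [show a = a - 1 + 1 by omega, wedgePrefix]
  -- For `l < b` the power of `N` either kills `y_l` or shifts it to one of `y_0, …, y_{a-2}`, which
  -- already occur in the product.
  · intro l hl
    rw [hφ]
    by_cases hs : b + 1 - a ≤ l
    · rw [h.pow_of_le (by omega) hs, wedgePrefix_mul_vec_of_mem_span]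
      · simp [coeff]
      · exact Submodule.subset_span ⟨_, by simp; omega, rfl⟩
    · rw [h.pow_of_lt (by omega) (by omega)]
      simp [coeff]

end IsJordanFrame

/-! ### The Weyl group action as permutation of scaling factors -/

/-- The steps of the affine flag `F` are the exterior products of the vectors `z_i y_i`. -/
def AffineFlag.HasScales (F : AffineFlag k) (y : ℕ → Vec k) (z : ℕ → ℂ) : Prop :=
  ∀ j, j ≤ k → F.step j = (∏ i ∈ Finset.range j, z i) • wedgePrefix y j

namespace AffineFlag

variable {u : SLk k} {y : ℕ → Vec k} {z : ℕ → ℂ} {F F' : AffineFlag k}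

theorem step_ne_zero (F : AffineFlag k) {j : ℕ} (hj : j ≤ k) : F.step j ≠ 0 := by
  induction hj using Nat.decreasingInduction with
  | self => rw [F.step_top]; exact volumeForm_ne_zero
  | of_succ j hj ih =>
    intro h0
    obtain ⟨v, hv⟩ := F.flag j hj
    rw [h0, zero_mul] at hv
    exact ih hv.symm

theorem prod_range_swap (z : ℕ → ℂ) (i j : ℕ) (hj : j ≠ i + 1) :
    ∏ l ∈ Finset.range j, z (Equiv.swap i (i + 1) l) = ∏ l ∈ Finset.range j, z l := by
  by_cases h : j < i + 1
  · refine Finset.prod_congr rfl fun l hl => ?_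
    rw [Finset.mem_range] at hl
    rw [Equiv.swap_apply_of_ne_of_ne (by omega) (by omega)]
  · refine Finset.prod_equiv (Equiv.swap i (i + 1)) (fun l => ?_) fun l _ => rfl
    simp only [Finset.mem_range]
    rw [Equiv.swap_apply_def]
    split_ifs <;> omega

theorem prod_range_swap_self (z : ℕ → ℂ) (i : ℕ) :
    ∏ l ∈ Finset.range (i + 1), z (Equiv.swap i (i + 1) l) =
      (∏ l ∈ Finset.range i, z l) * z (i + 1) := by
  rw [Finset.prod_range_succ, Equiv.swap_apply_left]
  congr 1
  refine Finset.prod_congr rfl fun l hl => ?_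
  rw [Finset.mem_range] at hl
  rw [Equiv.swap_apply_of_ne_of_ne (by omega) (by omega)]

/-- A simple reflection interchanges adjacent scaling factors. -/
theorem HasScales.of_isSimpleReflection (hF : F.HasScales y z) (hy : IsJordanFrame u y)
    (hz : ∀ i, z i ≠ 0) {i : ℕ} (hi : i + 1 < k) (h : IsSimpleReflection u i F F') :
    F'.HasScales y (z ∘ Equiv.swap i (i + 1)) := by
  obtain ⟨⟨v, hv, hv'⟩, hstep⟩ := h
  intro j hj
  by_cases hji : j = i + 1
  · subst hji
    simp only [Function.comp_apply]
    rw [prod_range_swap_self, hv', hF i (by omega), ← subOne_apply]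
    rw [hF _ hj, hF _ (by omega : i + 2 ≤ k), wedgePrefix, Finset.prod_range_succ, mul_smul,
      smul_mul_assoc] at hv
    have hP : ∏ l ∈ Finset.range (i + 1), z l ≠ 0 := Finset.prod_ne_zero_iff.2 fun l _ => hz l
    have h0 := smul_right_injective _ hP hv
    -- The vector `v` is only known to be `z_{i+1} y_{i+1}` modulo `y_0, …, y_i`. After applying `N`
    -- the ambiguity lies in the span of `y_0, …, y_{i-1}` and is killed by the exterior product.
    have h1 : wedgePrefix y (i + 1) * vec (v - z (i + 1) • y (i + 1)) = 0 := by
      rw [vec, map_sub, map_smul, mul_sub, mul_smul_comm, ← h0, sub_self]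
    have h2 := mem_span_of_wedgePrefix_mul_eq_zero (hy.ne_zero _ hj) h1
    have h3 := wedgePrefix_mul_vec_of_mem_span (hy.subOne_mem_span (by omega) h2)
    rw [map_sub, map_smul, hy.succ i hi, vec, map_sub, map_smul, mul_sub, mul_smul_comm,
      sub_eq_zero] at h3
    rw [smul_mul_assoc, mul_smul, h3]
    rfl
  · rw [hstep j hji, hF j hj]
    simp only [Function.comp_apply]
    rw [prod_range_swap _ _ _ hji]

/-- The affine flag obtained by rescaling one step. -/
def rescale (F : AffineFlag k) (i : ℕ) (hi : i + 1 < k) (c : ℂ) (hc : c ≠ 0) : AffineFlag k where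
  step j := if j = i + 1 then c • F.step j else F.step j
  step_mem j := by
    split_ifs
    · exact Submodule.smul_mem _ _ (F.step_mem j)
    · exact F.step_mem j
  step_zero := by simp [F.step_zero]
  step_top := by rw [if_neg (by omega), F.step_top]
  flag j hj := by
    obtain ⟨v, hv⟩ := F.flag j hj
    by_cases h1 : j = i
    · refine ⟨c • v, ?_⟩
      rw [if_neg (by omega), if_pos (by omega), vec, map_smul, mul_smul_comm, hv]
    · rw [if_neg (by omega : ¬ j + 1 = i + 1)]
      split_ifs
      · refine ⟨c⁻¹ • v, ?_⟩
        rw [vec, map_smul, mul_smul_comm, smul_mul_assoc, hv, smul_smul, inv_mul_cancel₀ hc,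
          one_smul]
      · exact ⟨v, hv⟩

theorem HasScales.exists_isSimpleReflection (hF : F.HasScales y z) (hy : IsJordanFrame u y)
    (hz : ∀ i, z i ≠ 0) {i : ℕ} (hi : i + 1 < k) : ∃ F', IsSimpleReflection u i F F' := by
  -- Interchanging `z_i` and `z_{i+1}` affects only the prefix product of length `i + 1`, in which
  -- `z_i` is replaced by `z_{i+1}`.
  refine ⟨F.rescale i hi (z (i + 1) / z i) (div_ne_zero (hz _) (hz _)),
    ⟨z (i + 1) • y (i + 1), ?_, ?_⟩, fun j hj => if_neg hj⟩
  · rw [hF _ (by omega), hF (i + 1) (by omega), wedgePrefix, Finset.prod_range_succ, vec_smul,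
      mul_smul_comm, smul_mul_assoc, smul_smul, mul_comm]
  · rw [← subOne_apply, map_smul, hy.succ i hi]
    simp only [rescale, if_true]
    rw [hF _ (by omega), hF i (by omega), wedgePrefix, Finset.prod_range_succ, smul_mul_assoc,
      vec_smul, mul_smul_comm, smul_smul, smul_smul]
    congr 1
    have := hz i
    field_simp

/-- The sequence of scaling factors permuted by `w`. -/
def permScales (z : ℕ → ℂ) (w : Equiv.Perm (Fin k)) (n : ℕ) : ℂ :=
  if h : n < k then z (w ⟨n, h⟩) else z n

theorem permScales_mul_swap (z : ℕ → ℂ) (w : Equiv.Perm (Fin k)) (i : ℕ) (hi : i + 1 < k) :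
    permScales z (w * Equiv.swap ⟨i, Nat.lt_of_succ_lt hi⟩ ⟨i + 1, hi⟩) =
      permScales z w ∘ Equiv.swap i (i + 1) := by
  funext n
  simp only [permScales, Function.comp_apply, Equiv.Perm.mul_apply, Equiv.swap_apply_def,
    Fin.ext_iff]
  split_ifs <;> first | rfl | omega

theorem permScales_ne_zero (hz : ∀ i, z i ≠ 0) (w : Equiv.Perm (Fin k)) (n : ℕ) :
    permScales z w n ≠ 0 := by
  unfold permScales
  split_ifs <;> exact hz _

/-- Right multiplication by an adjacent transposition interchanges two positions of the permuted
sequence, just as the reflection does. So the result depends on `w` alone and not on the word chosen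
for it. -/
theorem HasScales.of_isWeylTranslate (hF : F.HasScales y z) (hy : IsJordanFrame u y)
    (hz : ∀ i, z i ≠ 0) {w : Equiv.Perm (Fin k)} (h : IsWeylTranslate u F w F') :
    F'.HasScales y (permScales z w) := by
  induction h with
  | refl =>
    convert hF using 1
    funext n
    simp [permScales]
  | step i hi _ h2 ih =>
    rw [permScales_mul_swap]
    exact ih.of_isSimpleReflection hy (permScales_ne_zero hz _) hi h2

/-- Adjacent transpositions generate the symmetric group as a monoid, and no reflection along the
way can fail because the permuted scaling factors are still nonzero. -/
theorem HasScales.exists_isWeylTranslate (hF : F.HasScales y z) (hy : IsJordanFrame u y)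
    (hz : ∀ i, z i ≠ 0) (w : Equiv.Perm (Fin k)) : ∃ F', IsWeylTranslate u F w F' := by
  obtain rfl | ⟨n, rfl⟩ : k = 0 ∨ ∃ n, k = n + 1 := by cases k <;> simp
  · rw [Subsingleton.elim w 1]
    exact ⟨F, .refl⟩
  · have hw : w ∈ Submonoid.closure
        (Set.range fun i : Fin n ↦ Equiv.swap i.castSucc i.succ) := by
      rw [Equiv.Perm.mclosure_swap_castSucc_succ]
      trivial
    induction hw using Submonoid.closure_induction_right with
    | one => exact ⟨F, .refl⟩
    | mul_right w _ s hs ih =>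
      obtain ⟨i, rfl⟩ := hs
      obtain ⟨F', h'⟩ := ih
      have hi : (i : ℕ) + 1 < n + 1 := by omega
      obtain ⟨F'', h''⟩ := (hF.of_isWeylTranslate hy hz h').exists_isSimpleReflection hy
        (permScales_ne_zero hz w) hi
      exact ⟨F'', .step _ hi h' h''⟩

/-- The first `|A|` positions are carried bijectively onto `A`. This is why a leg tensor depends on
`w` only through `A`. -/
theorem prod_permScales (z : ℕ → ℂ) {w : Equiv.Perm (Fin k)} {A : Finset (Fin k)}
    (hw : ∀ j : Fin k, w j ∈ A ↔ (j : ℕ) < A.card) :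
    ∏ i ∈ Finset.range A.card, permScales z w i = ∏ i ∈ A, z i := by
  have hA : A.card ≤ k := by simpa using Finset.card_le_univ A
  symm
  refine Finset.prod_bij (fun i _ => ((w.symm i : Fin k) : ℕ)) (fun i hi => ?_)
    (fun i _ j _ hij => ?_) (fun n hn => ?_) (fun i hi => ?_)
  · rw [Finset.mem_range, ← hw, Equiv.apply_symm_apply]
    exact hi
  · simpa using Fin.ext hij
  · rw [Finset.mem_range] at hn
    exact ⟨w ⟨n, by omega⟩, (hw _).2 hn, by simp⟩
  · simp [permScales]

theorem exists_perm_mem_iff (A : Finset (Fin k)) :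
    ∃ w : Equiv.Perm (Fin k), ∀ j : Fin k, w j ∈ A ↔ (j : ℕ) < A.card := by
  have hA : A.card ≤ k := by simpa using Finset.card_le_univ A
  let B : Finset (Fin k) := Finset.univ.filter fun j => (j : ℕ) < A.card
  have hB : B.card = A.card := by
    simp only [B]
    rw [Fin.card_filter_val_lt]
    omega
  obtain ⟨w, hw⟩ : ∃ w : Equiv.Perm (Fin k), ∀ j, j ∈ B ↔ w j ∈ A := by
    let f : {j // j ∈ B} ≃ {j // j ∈ A} := Finset.equivOfCardEq hB
    refine ⟨f.extendSubtype, fun j => ⟨fun h => f.extendSubtype_mem j h, fun h => ?_⟩⟩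
    by_contra hj
    exact f.extendSubtype_not_mem j hj h
  exact ⟨w, fun j => by rw [← hw]; simp [B]⟩

/-- The leg tensors in terms of a Jordan basis. -/
theorem HasScales.legTensor_eq (hF : F.HasScales y z) (hy : IsJordanFrame u y)
    (hz : ∀ i, z i ≠ 0) (A : Finset (Fin k)) :
    legTensor u F A = (∏ i ∈ A, z i) • wedgePrefix y A.card := by
  have hA : A.card ≤ k := by simpa using Finset.card_le_univ A
  have key (t : ExtAlg k) (ht : IsLegTensor u F A t) :
      t = (∏ i ∈ A, z i) • wedgePrefix y A.card := by
    obtain ⟨w, F', h1, h2, rfl⟩ := ht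
    rw [hF.of_isWeylTranslate hy hz h1 _ hA, prod_permScales z h2]
  -- This excludes the default value `0` of `legTensor`; by `key` the choice made there is
  -- immaterial.
  have hex : ∃ t, IsLegTensor u F A t := by
    obtain ⟨w, hw⟩ := exists_perm_mem_iff A
    obtain ⟨F', h'⟩ := hF.exists_isWeylTranslate hy hz w
    exact ⟨_, w, F', h', hw, rfl⟩
  rw [legTensor, dif_pos hex]
  exact key _ hex.choose_spec

/-! ### From generic flags to Jordan bases, and the exchange of leg tensors -/

theorem exists_step_eq_wedgePrefix (F : AffineFlag k) :
    ∃ v : ℕ → Vec k, ∀ j, j ≤ k → F.step j = wedgePrefix v j := by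
  choose! v hv using F.flag
  refine ⟨v, fun j => ?_⟩
  induction j with
  | zero => intro _; exact F.step_zero
  | succ j ih => intro hj; rw [← hv j hj, ih (by omega), wedgePrefix]

theorem mem_span_image_Iio_succ {v : ℕ → Vec k} {l : ℕ} {w : Vec k}
    (hw : w ∈ Submodule.span ℂ (v '' Set.Iio (l + 1))) :
    ∃ c : ℂ, w - c • v l ∈ Submodule.span ℂ (v '' Set.Iio l) := by
  have : v '' Set.Iio (l + 1) = insert (v l) (v '' Set.Iio l) := by
    rw [← Set.image_insert_eq]
    congr 1
    ext i
    simp only [Set.mem_Iio, Set.mem_insert_iff]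
    omega
  rw [this] at hw
  obtain ⟨c, t, ht, rfl⟩ := Submodule.mem_span_insert.1 hw
  exact ⟨c, by simpa using ht⟩

/-- Because `u` fixes the tensors `F_(l)` and `F_(l+1) = F_(l) ∧ v_l` themselves, and not just their
spans, `F_(l) ∧ (u v_l - v_l) = 0`. -/
theorem IsStabilizedBy.subOne_mem_span (h : F.IsStabilizedBy u) {v : ℕ → Vec k}
    (hv : ∀ j, j ≤ k → F.step j = wedgePrefix v j) {l : ℕ} (hl : l < k) :
    subOne u (v l) ∈ Submodule.span ℂ (v '' Set.Iio l) := by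
  refine mem_span_of_wedgePrefix_mul_eq_zero ?_ ?_
  · rw [← hv l hl.le]
    exact F.step_ne_zero hl.le
  · have h1 := h (l + 1)
    rw [hv _ hl, wedgePrefix, map_mul, ← hv l hl.le, h l, act_vec] at h1
    rw [← hv l hl.le, subOne_apply, vec, map_sub, mul_sub, h1, sub_self]

/-- A generic affine flag stabilized by `u` is obtained from a Jordan basis for `u` by
rescaling. -/
theorem IsGeneric.exists_jordanFrame (hk : 1 ≤ k) (hg : F.IsGeneric u) (hs : F.IsStabilizedBy u) :
    ∃ (y : ℕ → Vec k) (z : ℕ → ℂ), IsJordanFrame u y ∧ (∀ i, z i ≠ 0) ∧ F.HasScales y z := by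
  obtain ⟨v, hv⟩ := F.exists_step_eq_wedgePrefix
  have hv0 : ∀ j, j ≤ k → wedgePrefix v j ≠ 0 := fun j hj => hv j hj ▸ F.step_ne_zero hj
  have hN : ∀ l, l < k → subOne u (v l) ∈ Submodule.span ℂ (v '' Set.Iio l) :=
    fun l hl => hs.subOne_mem_span hv hl
  have hNW : ∀ j, j < k → ∀ w ∈ Submodule.span ℂ (v '' Set.Iio (j + 1)),
      subOne u w ∈ Submodule.span ℂ (v '' Set.Iio j) := by
    intro j hj w hw
    induction hw using Submodule.span_induction with
    | mem w hw =>
      obtain ⟨l, hl, rfl⟩ := hw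
      rw [Set.mem_Iio] at hl
      exact Submodule.span_mono (Set.image_mono fun i hi => by simp at hi ⊢; omega)
        (hN l (by omega))
    | zero => rw [map_zero]; exact zero_mem _
    | add v w _ _ hv hw => rw [map_add]; exact add_mem hv hw
    | smul r v _ hv => rw [map_smul]; exact Submodule.smul_mem _ _ hv
  -- Here genericity enters: if the coefficient of `v_l` in `N v_{l+1}` vanished, the reflected flag
  -- would have a zero step.
  have hc : ∀ l, l + 1 < k → ∃ c : ℂ, c ≠ 0 ∧
      subOne u (v (l + 1)) - c • v l ∈ Submodule.span ℂ (v '' Set.Iio l) := by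
    intro l hl
    obtain ⟨c, hc⟩ := mem_span_image_Iio_succ (hN (l + 1) hl)
    refine ⟨c, ?_, hc⟩
    rintro rfl
    rw [zero_smul, sub_zero] at hc
    obtain ⟨F', ⟨w, hw, hw'⟩, -⟩ := hg l hl
    refine F'.step_ne_zero (j := l + 1) (by omega) ?_
    rw [hv _ (by omega), hv (l + 1) (by omega)] at hw
    have h1 : wedgePrefix v (l + 1) * vec (w - v (l + 1)) = 0 := by
      rw [vec, map_sub, mul_sub, ← hw, wedgePrefix, sub_self]
    have h2 := hNW l (by omega) _ (mem_span_of_wedgePrefix_mul_eq_zero (hv0 _ (by omega)) h1)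
    rw [map_sub] at h2
    have h3 := add_mem h2 hc
    rw [sub_add_cancel] at h3
    rw [hw', ← subOne_apply, hv l (by omega)]
    exact wedgePrefix_mul_vec_of_mem_span h3
  -- Descending from the top vector makes the chain condition automatic. By `hc`, each `y_l` is a
  -- nonzero multiple of `v_l` plus lower terms.
  let y : ℕ → Vec k := fun l => (subOne u ^ (k - 1 - l)) (v (k - 1))
  have hy : ∀ l, l + 1 < k → subOne u (y (l + 1)) = y l := by
    intro l hl
    simp only [y]
    rw [← Module.End.mul_apply, ← pow_succ', show k - 1 - (l + 1) + 1 = k - 1 - l by omega]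
  have hyv : ∀ l, l ≤ k - 1 → ∃ α : ℂ, α ≠ 0 ∧
      y l - α • v l ∈ Submodule.span ℂ (v '' Set.Iio l) := by
    intro l hl
    induction hl using Nat.decreasingInduction with
    | self => exact ⟨1, one_ne_zero, by simp [y]⟩
    | of_succ l hl ih =>
      obtain ⟨α, hα, h1⟩ := ih
      obtain ⟨c, hc0, h2⟩ := hc l (by omega)
      refine ⟨α * c, mul_ne_zero hα hc0, ?_⟩
      have h3 := add_mem (hNW l (by omega) _ h1) (Submodule.smul_mem _ α h2)
      rw [map_sub, map_smul, hy l (by omega), smul_sub, smul_smul] at h3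
      simpa using h3
  choose! α hα0 hα using hyv
  have hα' : ∀ l, l < k → wedgePrefix v l * vec (y l) = α l • wedgePrefix v (l + 1) := by
    intro l hl
    have := wedgePrefix_mul_vec_of_mem_span (hα l (by omega))
    rw [vec, map_sub, map_smul, mul_sub, mul_smul_comm, sub_eq_zero] at this
    exact this
  -- The scalars undo the leading coefficients `α_l`. The value `1` from `k` on only serves to keep
  -- every `z_i` nonzero.
  let z : ℕ → ℂ := fun l => if l < k then (α l)⁻¹ else 1
  have hz : ∀ i, z i ≠ 0 := by
    intro i
    simp only [z]
    split_ifs with h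
    · exact inv_ne_zero (hα0 i (by omega))
    · exact one_ne_zero
  have hyz : ∀ j, j ≤ k → wedgePrefix v j = (∏ i ∈ Finset.range j, z i) • wedgePrefix y j := by
    intro j
    induction j with
    | zero => simp [wedgePrefix]
    | succ j ih =>
      intro hj
      have h1 := hα' j hj
      rw [ih (by omega), smul_mul_assoc] at h1
      rw [wedgePrefix, Finset.prod_range_succ, mul_comm, mul_smul]
      change _ = z j • _ • (wedgePrefix y j * vec (y j))
      rw [h1]
      simp only [z, if_pos (show j < k by omega), smul_smul]
      rw [inv_mul_cancel₀ (hα0 j (by omega)), one_smul]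
      rfl
  refine ⟨y, z, ⟨?_, hy, fun j hj h0 => ?_⟩, hz, fun j hj => by rw [hv j hj, hyz j hj]⟩
  · have h1 := hα 0 (by omega)
    have h2 := hN 0 (by omega)
    have h3 : v '' Set.Iio 0 = ∅ := by
      rw [Set.image_eq_empty]
      ext i
      simp
    rw [h3, Submodule.span_empty, Submodule.mem_bot] at h1 h2
    rw [sub_eq_zero.1 h1, map_smul, h2, smul_zero]
  · refine hv0 j hj ?_
    rw [hyz j hj, h0, smul_zero]

theorem IsGeneric.legTensor_mem (hk : 1 ≤ k) (hg : F.IsGeneric u) (hs : F.IsStabilizedBy u)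
    (A : Finset (Fin k)) :
    legTensor u F A ∈ (⋀[ℂ]^A.card (Vec k) : Submodule ℂ (ExtAlg k)) := by
  obtain ⟨y, z, hy, hz, hF⟩ := hg.exists_jordanFrame hk hs
  rw [hF.legTensor_eq hy hz]
  exact Submodule.smul_mem _ _ (wedgePrefix_mem _ _)

/-- The exchange relation between leg tensors. -/
theorem IsGeneric.legTensor_exchange (hk : 1 ≤ k) (hg : F.IsGeneric u) (hs : F.IsStabilizedBy u)
    {A B : Finset (Fin k)} {i : Fin k} (hA : i ∈ A) (hB : i ∉ B) (hAB : A.card ≤ B.card + 1)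
    (K₁ K₂ : Finset (Fin k)) :
    ∑ j ∈ Finset.range (B.card + 1 - A.card + 1),
      ((-1 : ℂ) ^ (B.card + 1 - A.card - j) * (B.card + 1 - A.card).choose j) *
      ∑ m, (∑ I, coeff I (legTensor u F (insert i B)) * coeff I (stdBasis k K₂ * vec (e m))) *
        coeff K₁ (legTensor u F (A.erase i) * vec ((u ^ j).1.mulVec (e m))) =
    coeff K₁ (legTensor u F A) * coeff K₂ (legTensor u F B) := by
  obtain ⟨y, z, hy, hz, hF⟩ := hg.exists_jordanFrame hk hs
  have hBk : B.card < k := by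
    have := Finset.card_le_univ (insert i B)
    rw [Finset.card_insert_of_notMem hB, Fintype.card_fin] at this
    omega
  have hA1 : 1 ≤ A.card := Finset.card_pos.2 ⟨i, hA⟩
  have key := hy.exchange hA1 hAB hBk K₁ K₂
  simp only [hF.legTensor_eq hy hz, Finset.card_insert_of_notMem hB, Finset.card_erase_of_mem hA,
    coeff_smul, smul_mul_assoc, Finset.prod_insert hB]
  -- Both sides now carry the product of `z` over `A` times that over `B`, with the factor `z_i`
  -- merely regrouped. What remains is the relation for the Jordan basis.
  rw [← Finset.mul_prod_erase A (fun i : Fin k => z i) hA]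
  have h1 (m : Fin k) : coeff K₁ (wedgePrefix y (A.card - 1) *
      vec ((subOne u ^ (B.card + 1 - A.card)) (e m))) =
      ∑ j ∈ Finset.range (B.card + 1 - A.card + 1),
      ((-1 : ℂ) ^ (B.card + 1 - A.card - j) * (B.card + 1 - A.card).choose j) *
      coeff K₁ (wedgePrefix y (A.card - 1) * vec ((u ^ j).1.mulVec (e m))) := by
    rw [subOne_pow_apply, vec, map_sum, Finset.mul_sum, ← coeffₗ_apply, map_sum]
    refine Finset.sum_congr rfl fun j _ => ?_
    rw [map_smul, mul_smul_comm, map_smul, smul_eq_mul, coeffₗ_apply]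
  simp only [h1] at key
  simp only [Finset.mul_sum] at key ⊢
  rw [Finset.sum_comm]
  have h2 (c d p q : ℂ) : c * p * (d * q) = (c * d) * (p * q) := by ring
  rw [h2, ← key]
  rw [Finset.mul_sum]
  refine Finset.sum_congr rfl fun m _ => ?_
  rw [Finset.mul_sum]
  refine Finset.sum_congr rfl fun j _ => ?_
  simp only [mul_assoc, ← Finset.mul_sum]
  ring

end AffineFlag
end

/-! ### State sum of the part of a diagram that is added by an exchange -/

noncomputable section

open ExtAlg

section PiFinset

variable {α β γ δ : Type*} [AddCommMonoid δ]

theorem sum_piFinset_sum [Fintype α] [Fintype β] [DecidableEq α] [DecidableEq β]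
    [DecidableEq (α ⊕ β)] (s : α ⊕ β → Finset γ) (f : (α ⊕ β → γ) → δ) :
    ∑ x ∈ Fintype.piFinset s, f x = ∑ x ∈ Fintype.piFinset fun a => s (.inl a),
      ∑ y ∈ Fintype.piFinset fun b => s (.inr b), f (Sum.elim x y) := by
  rw [← Finset.sum_product']
  refine Finset.sum_equiv (Equiv.sumArrowEquivProdArrow α β γ) (fun x => ?_) fun x _ => ?_
  · simp [Fintype.mem_piFinset, Equiv.sumArrowEquivProdArrow]
  · exact congrArg f (Sum.elim_comp_inl_inr x).symm

theorem sum_piFinset_unique [Fintype α] [DecidableEq α] [Unique α] (s : α → Finset γ)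
    (f : (α → γ) → δ) :
    ∑ x ∈ Fintype.piFinset s, f x = ∑ a ∈ s default, f fun _ => a := by
  refine Finset.sum_equiv (Equiv.funUnique α γ) (fun x => ?_) fun x _ => ?_
  · simp [Fintype.mem_piFinset, Unique.forall_iff]
  · congr 1
    funext a
    rw [Unique.eq_default a]
    rfl

theorem sum_piFinset_isEmpty [Fintype α] [DecidableEq α] [IsEmpty α] (s : α → Finset γ)
    (f : (α → γ) → δ) : ∑ x ∈ Fintype.piFinset s, f x = f isEmptyElim := by
  have : Fintype.piFinset s = {isEmptyElim} := by
    ext x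
    simp only [Fintype.mem_piFinset, IsEmpty.forall_iff, Finset.mem_singleton, true_iff]
    exact Subsingleton.elim _ _
  rw [this, Finset.sum_singleton]

end PiFinset

namespace ExtAlg

variable {k : ℕ}

/-- The weights of the edges which are added when an element is exchanged between two legs: the
leg with the larger set, the edge winding around the puncture, and the leg with the smaller set
(which is absent if this set is empty). -/
def exchangeWt (nU nL : ℕ) {l : ℕ} : Unit ⊕ Unit ⊕ Fin l → ℕ
  | .inl _ => nU
  | .inr (.inl _) => 1
  | .inr (.inr _) => nL

/-- The coefficients of the tensors at the sources of the added edges. -/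
def exchangeSource (tU tL : ExtAlg k) {l : ℕ} : Unit ⊕ Unit ⊕ Fin l → Finset (Fin k) → ℂ
  | .inl _, I => coeff I tU
  | .inr (.inl _), _ => 1
  | .inr (.inr _), I => coeff I tL

/-- The transport along the added edges. -/
def exchangeTransport (g : SLk k) {l : ℕ} : Unit ⊕ Unit ⊕ Fin l → SLk k
  | .inl _ => 1
  | .inr (.inl _) => g
  | .inr (.inr _) => 1

/-- The matrix coefficients of the tensor which the added part of the diagram assigns to the
two exchanged edges. -/
def exchangeTensor (nU nL l : ℕ) (tU tL : ExtAlg k) (g : SLk k) (K₁ K₂ : Finset (Fin k)) : ℂ :=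
  ∑ I ∈ Fintype.piFinset fun x : Unit ⊕ Unit ⊕ Fin l =>
    Finset.powersetCard (exchangeWt nU nL x) (Finset.univ : Finset (Fin k)),
  ∑ J ∈ Fintype.piFinset fun x : Unit ⊕ Unit ⊕ Fin l =>
    Finset.powersetCard (exchangeWt nU nL x) (Finset.univ : Finset (Fin k)),
    (∏ x, exchangeSource tU tL x (I x)) *
    (∏ x, coeff (J x) (act (exchangeTransport g x) (stdBasis k (I x)))) *
    (VertexKind.dualWedge.coeff [J (.inl ())] [I (.inr (.inl ())), K₂] *
      VertexKind.wedge.coeff ((List.finRange l).map (fun x => J (.inr (.inr x))) ++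
        [J (.inr (.inl ()))]) [K₁])

theorem sum_coeff_act_one (n : ℕ) (I : Finset (Fin k)) (hI : I ∈ Finset.powersetCard n Finset.univ)
    (f : Finset (Fin k) → ℂ) :
    ∑ J ∈ Finset.powersetCard n Finset.univ, coeff J (act (1 : SLk k) (stdBasis k I)) * f J =
      f I := by
  simp only [act_one, coeff_stdBasis, ite_mul, one_mul, zero_mul]
  rw [Finset.sum_ite_eq, if_pos hI]

theorem sum_coeff_mul_coeff_mul {n : ℕ} {t : ExtAlg k}
    (ht : t ∈ (⋀[ℂ]^n (Vec k) : Submodule ℂ (ExtAlg k))) (K : Finset (Fin k)) (s : ExtAlg k) :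
    ∑ I ∈ Finset.powersetCard n Finset.univ, coeff I t * coeff K (stdBasis k I * s) =
      coeff K (t * s) := by
  conv_rhs => rw [← sum_coeff_powersetCard ht, Finset.sum_mul, ← coeffₗ_apply, map_sum]
  refine Finset.sum_congr rfl fun I _ => ?_
  rw [smul_mul_assoc, map_smul, smul_eq_mul, coeffₗ_apply]

theorem vec_mem (v : Vec k) : vec v ∈ (⋀[ℂ]^1 (Vec k) : Submodule ℂ (ExtAlg k)) := by
  rw [ExteriorAlgebra.exteriorPower, pow_one]
  exact ⟨v, rfl⟩

theorem sum_powersetCard_one {δ : Type*} [AddCommMonoid δ] (f : Finset (Fin k) → δ) :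
    ∑ I ∈ Finset.powersetCard 1 Finset.univ, f I = ∑ m, f {m} := by
  rw [Finset.powersetCard_one, Finset.sum_map]
  rfl

/-- The new legs have trivial transport, so their two labels agree. The winding edge has weight one,
so it starts with some `e_m`, and the sum over its end label assembles `g e_m`. The two vertices
contribute the remaining coefficients. -/
theorem exchangeTensor_eq {nU nL l : ℕ} {tU tL : ExtAlg k} (g : SLk k)
    (hU : tU ∈ (⋀[ℂ]^nU (Vec k) : Submodule ℂ (ExtAlg k)))
    (hL : tL ∈ (⋀[ℂ]^nL (Vec k) : Submodule ℂ (ExtAlg k))) (hl : l ≤ 1) (hl0 : l = 0 → tL = 1)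
    (K₁ K₂ : Finset (Fin k)) :
    exchangeTensor nU nL l tU tL g K₁ K₂ =
      ∑ m, (∑ I, coeff I tU * coeff I (stdBasis k K₂ * vec (e m))) *
        coeff K₁ (tL * vec (g.1.mulVec (e m))) := by
  have hU' (X : ExtAlg k) : ∑ I, coeff I tU * coeff I X =
      ∑ I ∈ Finset.powersetCard nU Finset.univ, coeff I tU * coeff I X := by
    symm
    refine Finset.sum_subset (Finset.subset_univ _) fun I _ hI => ?_
    rw [coeff_eq_zero_of_mem hU, zero_mul]
    simpa using hI
  have hg (X : ExtAlg k) (m : Fin k) : ∑ J ∈ Finset.powersetCard 1 Finset.univ,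
      coeff J (act g (stdBasis k {m})) * coeff K₁ (X * stdBasis k J) =
      coeff K₁ (X * vec (g.1.mulVec (e m))) := by
    rw [stdBasis_singleton, act_vec]
    conv_rhs => rw [← sum_coeff_powersetCard (vec_mem (g.1.mulVec (e m))), Finset.mul_sum,
      ← coeffₗ_apply, map_sum]
    refine Finset.sum_congr rfl fun I _ => ?_
    rw [mul_smul_comm, map_smul, smul_eq_mul, coeffₗ_apply]
  simp only [hU']
  unfold exchangeTensor
  rw [sum_piFinset_sum]
  simp only [sum_piFinset_sum, sum_piFinset_unique]
  simp only [Fintype.prod_sum_type, Sum.elim_inl, Sum.elim_inr, exchangeWt, exchangeSource,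
    exchangeTransport, VertexKind.coeff, Finset.univ_unique, Finset.prod_singleton,
    sum_powersetCard_one, List.map_cons, List.map_nil, List.reverse_cons, List.reverse_nil,
    List.nil_append, List.cons_append, List.prod_cons, List.prod_nil, mul_one, one_mul]
  simp only [sum_powersetCard_one] at hg
  -- Without a lower leg the exterior product vertex has just one incoming edge; this agrees with
  -- the formula because then `tL = 1`.
  obtain rfl | rfl : l = 0 ∨ l = 1 := by omega
  · simp only [sum_piFinset_isEmpty, List.finRange_zero, List.map_nil, List.nil_append,
      List.map_cons, List.prod_cons, List.prod_nil, mul_one, Finset.univ_eq_empty,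
      Finset.prod_empty]
    rw [Finset.sum_comm]
    refine Finset.sum_congr rfl fun m _ => ?_
    rw [Finset.sum_mul]
    refine Finset.sum_congr rfl fun I hI => ?_
    rw [← sum_coeff_act_one nU I hI fun J => coeff J (stdBasis k K₂ * vec (e m)), ← hg,
      hl0 rfl, mul_assoc, Finset.sum_mul, Finset.mul_sum]
    refine Finset.sum_congr rfl fun J _ => ?_
    rw [Finset.mul_sum, Finset.mul_sum]
    refine Finset.sum_congr rfl fun j _ => ?_
    rw [one_mul, stdBasis_singleton m]
    ring
  · simp only [sum_piFinset_unique, List.finRange_succ, List.finRange_zero, List.map_nil,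
      List.nil_append, List.map_cons, List.prod_cons, List.prod_nil, mul_one, Finset.univ_unique,
      Finset.prod_singleton, List.cons_append]
    rw [Finset.sum_comm]
    refine Finset.sum_congr rfl fun m _ => ?_
    rw [Finset.sum_mul]
    refine Finset.sum_congr rfl fun I hI => ?_
    rw [← sum_coeff_mul_coeff_mul hL, Finset.mul_sum]
    refine Finset.sum_congr rfl fun L hL' => ?_
    rw [← sum_coeff_act_one nU I hI fun J => coeff J (stdBasis k K₂ * vec (e m)), ← hg,
      mul_assoc, Finset.sum_mul, Finset.mul_sum]
    refine Finset.sum_congr rfl fun J _ => ?_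
    rw [Finset.mul_sum, Finset.mul_sum, Finset.mul_sum]
    refine Finset.sum_congr rfl fun j _ => ?_
    rw [← sum_coeff_act_one nL L hL' fun J => coeff K₁ (stdBasis k J * stdBasis k {j}),
      Finset.mul_sum, Finset.mul_sum, Finset.mul_sum, Finset.mul_sum]
    refine Finset.sum_congr rfl fun x _ => ?_
    rw [stdBasis_singleton m]
    ring

end ExtAlg
end

/-! ### The diagram obtained by an exchange -/

noncomputable section

open ExtAlg

namespace MarkedSurface

variable {S : Type*} [TopologicalSpace S] [ChartedSpace (EuclideanHalfSpace 2) S]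
  [IsManifold (𝓡∂ 2) ∞ S] {M : MarkedSurface S} {k : ℕ} {c : Flavor}

/-- The arc which runs `j` times around a puncture. -/
def loopPow (p : M.punctures) : ℕ → M.Arc (M.punctureBase p) (M.punctureBase p)
  | 0 => .refl _
  | j + 1 => (loopPow p j).trans (.mk (M.punctureLoop p))

theorem DecoratedLocalSystem.transport_loopPow (z : M.DecoratedLocalSystem k c) (p : M.punctures)
    (j : ℕ) : z.transport (loopPow p j) = z.monodromy p ^ j := by
  induction j with
  | zero => rw [loopPow, z.transport_refl, pow_zero]
  | succ j ih => rw [loopPow, z.transport_trans, ih, pow_succ']; rfl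

theorem DecoratedLocalSystem.transport_cast (z : M.DecoratedLocalSystem k c)
    {a a' b : M.TangentDirections} (γ : M.Arc a b) (h : a' = a) :
    z.transport (γ.cast h rfl) = z.transport γ := by
  subst h
  rw [Path.Homotopic.Quotient.cast_rfl_rfl]

theorem isInteriorPoint_punctureBase (p : M.punctures) :
    (𝓡∂ 2).IsInteriorPoint (M.punctureBase p).1.proj :=
  (M.disk p).interior _ ((M.disk p).chart.map_target (M.circle_mem_target p 0))

/-- The vertex of a larger diagram which corresponds to a vertex of a subdiagram. -/
def Vertex.map {V V' : Type} (f : V → V') : M.Vertex V → M.Vertex V'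
  | .inner v => .inner (f v)
  | .puncture p => .puncture p
  | .boundary q => .boundary q

theorem Vertex.location_map {V V' : Type} (f : V → V') (pos : V' → M.TangentDirections)
    (x : M.Vertex V) : (x.map f).location pos = x.location fun v => pos (f v) := by
  cases x <;> rfl

theorem Vertex.map_eq_inner {V V' : Type} {f : V → V'} {x : M.Vertex V} {w : V'} :
    x.map f = .inner w ↔ ∃ v, x = .inner v ∧ f v = w := by
  cases x <;> simp [Vertex.map]

theorem Vertex.map_eq_puncture {V V' : Type} {f : V → V'} {x : M.Vertex V} {p : M.punctures} :
    x.map f = .puncture p ↔ x = .puncture p := by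
  cases x <;> simp [Vertex.map]

theorem Vertex.map_eq_boundary {V V' : Type} {f : V → V'} {x : M.Vertex V}
    {q : M.boundaryPoints} : x.map f = .boundary q ↔ x = .boundary q := by
  cases x <;> simp [Vertex.map]

namespace TensorDiagram

variable {T : M.TensorDiagram k c} (φ : T.Pseudotagging) (z : M.DecoratedLocalSystem k c)

theorem sourceCoeff_inner {e : T.E} {v : T.V} (h : T.src e = .inner v) (I : Finset (Fin k)) :
    sourceCoeff φ z e I = 1 := by
  unfold sourceCoeff
  split <;> simp_all

theorem sourceCoeff_puncture {e : T.E} {p : M.punctures} (h : T.src e = .puncture p)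
    (I : Finset (Fin k)) : sourceCoeff φ z e I =
      ExtAlg.coeff I (legTensor (z.monodromy p) (z.flag p) (φ.tag ⟨e, p, h⟩)) := by
  unfold sourceCoeff
  split
  · simp_all
  · rename_i p' h'
    obtain rfl : p = p' := by rw [h] at h'; exact Vertex.puncture.inj h'
    rfl
  · simp_all

theorem sourceCoeff_boundary {e : T.E} {q : M.boundaryPoints} (h : T.src e = .boundary q)
    (I : Finset (Fin k)) : sourceCoeff φ z e I =
      ExtAlg.coeff I ((z.decoration q).tensor (T.wt e)) := by
  unfold sourceCoeff
  split
  · simp_all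
  · simp_all
  · rename_i q' h'
    obtain rfl : q = q' := by rw [h] at h'; exact Vertex.boundary.inj h'
    rfl

/-- Two legs `e₁`, `e₂` at the same puncture and an element `i` of the set at `e₁` which is not in
the set at `e₂`. -/
structure ExchangeSite where
  p : M.punctures
  e₁ : T.E
  e₂ : T.E
  src₁ : T.src e₁ = .puncture p
  src₂ : T.src e₂ = .puncture p
  i : Fin k
  mem : i ∈ φ.tag ⟨e₁, p, src₁⟩
  notMem : i ∉ φ.tag ⟨e₂, p, src₂⟩

namespace ExchangeSite

variable {φ} (s : ExchangeSite φ)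

/-- The set at the first leg. -/
def setA : Finset (Fin k) := φ.tag ⟨s.e₁, s.p, s.src₁⟩

/-- The set at the second leg. -/
def setB : Finset (Fin k) := φ.tag ⟨s.e₂, s.p, s.src₂⟩

theorem card_setA : s.setA.card = T.wt s.e₁ := φ.card_tag _

theorem card_setB : s.setB.card = T.wt s.e₂ := φ.card_tag _

theorem card_insert : (insert s.i s.setB).card = T.wt s.e₂ + 1 := by
  rw [Finset.card_insert_of_notMem (show s.i ∉ s.setB from s.notMem), s.card_setB]

theorem card_erase : (s.setA.erase s.i).card = T.wt s.e₁ - 1 := by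
  rw [Finset.card_erase_of_mem (show s.i ∈ s.setA from s.mem), s.card_setA]

theorem wt_lt : T.wt s.e₂ < k := by
  have := Finset.card_le_univ (insert s.i s.setB)
  rw [s.card_insert, Fintype.card_fin] at this
  omega

theorem ne : s.e₂ ≠ s.e₁ := by
  have h1 := s.mem
  have h2 := s.notMem
  intro h
  simp only [h] at h2
  exact h2 h1

/-- The number of legs with the smaller set. -/
def lower : ℕ := min (T.wt s.e₁ - 1) 1

/-- The vertices: a dual exterior product vertex `false` and an exterior product vertex `true` are
added. -/
abbrev V (_ : ExchangeSite φ) : Type := T.V ⊕ Bool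

/-- The edges. -/
abbrev E : Type := T.E ⊕ (Unit ⊕ Unit ⊕ Fin s.lower)

/-- The two old legs are detached from the puncture: `e₁` now leaves the exterior product vertex and
`e₂` the dual one. The leg with the larger set feeds the dual vertex, which passes one vector to the
exterior product vertex. -/
def src : s.E → M.Vertex s.V
  | .inl e => if e = s.e₁ then .inner (.inr true) else if e = s.e₂ then .inner (.inr false) else
      (T.src e).map .inl
  | .inr (.inl _) => .puncture s.p
  | .inr (.inr (.inl _)) => .inner (.inr false)
  | .inr (.inr (.inr _)) => .puncture s.p

def tgt : s.E → s.V
  | .inl e => .inl (T.tgt e)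
  | .inr (.inl _) => .inr false
  | .inr (.inr (.inl _)) => .inr true
  | .inr (.inr (.inr _)) => .inr true

/-- The new vertices sit at the base point of the puncture, so `e₁` and `e₂` keep their arcs and the
new legs can have constant arcs. -/
def pos : s.V → M.TangentDirections
  | .inl v => T.pos v
  | .inr _ => M.punctureBase s.p

def kind : s.V → VertexKind
  | .inl v => T.kind v
  | .inr true => .wedge
  | .inr false => .dualWedge

def wt : s.E → ℕ
  | .inl e => T.wt e
  | .inr x => exchangeWt (T.wt s.e₂ + 1) (T.wt s.e₁ - 1) x

def inEdges : s.V → List s.E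
  | .inl v => (T.inEdges v).map .inl
  | .inr false => [.inr (.inl ())]
  | .inr true => (List.finRange s.lower).map (fun x => .inr (.inr (.inr x))) ++
      [.inr (.inr (.inl ()))]

/-- The order at the dual vertex matters. Its coefficient reverses the list, so the winding edge
receives the last exterior factor, as in a contraction from the right, and no sign appears. -/
def outEdges : s.V → List s.E
  | .inl v => (T.outEdges v).map .inl
  | .inr false => [.inr (.inr (.inl ())), .inl s.e₂]
  | .inr true => [.inl s.e₁]

theorem src_inl_e₁ : s.src (.inl s.e₁) = .inner (.inr true) := if_pos rfl

theorem src_inl_e₂ : s.src (.inl s.e₂) = .inner (.inr false) := by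
  simp [src, s.ne]

theorem src_inl_of_ne {e : T.E} (h₁ : e ≠ s.e₁) (h₂ : e ≠ s.e₂) :
    s.src (.inl e) = (T.src e).map .inl := by
  simp [src, h₁, h₂]

theorem location_src_inl (e : T.E) :
    (s.src (.inl e)).location s.pos = (T.src e).location T.pos := by
  by_cases h₁ : e = s.e₁
  · subst h₁
    rw [src_inl_e₁, s.src₁]
    rfl
  by_cases h₂ : e = s.e₂
  · subst h₂
    rw [src_inl_e₂, s.src₂]
    rfl
  rw [s.src_inl_of_ne h₁ h₂, Vertex.location_map]
  rfl

theorem src_inl_eq_inner_inl {e : T.E} {v : T.V} :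
    s.src (.inl e) = .inner (.inl v) ↔ T.src e = .inner v := by
  by_cases h₁ : e = s.e₁
  · subst h₁
    simp [src_inl_e₁, s.src₁]
  by_cases h₂ : e = s.e₂
  · subst h₂
    simp [src_inl_e₂, s.src₂]
  rw [s.src_inl_of_ne h₁ h₂, Vertex.map_eq_inner]
  simp

theorem src_inl_eq_puncture {e : T.E} {p : M.punctures} (h : s.src (.inl e) = .puncture p) :
    e ≠ s.e₁ ∧ e ≠ s.e₂ ∧ T.src e = .puncture p := by
  by_cases h₁ : e = s.e₁
  · subst h₁
    simp [src_inl_e₁] at h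
  by_cases h₂ : e = s.e₂
  · subst h₂
    simp [src_inl_e₂] at h
  rw [s.src_inl_of_ne h₁ h₂, Vertex.map_eq_puncture] at h
  exact ⟨h₁, h₂, h⟩

/-- The arcs of the edges, where the new edge between the two new vertices runs `j` times around
the puncture. -/
def arc (j : ℕ) : ∀ e, M.Arc ((s.src e).location s.pos) (s.pos (s.tgt e))
  | .inl e => (T.arc e).cast (s.location_src_inl e) rfl
  | .inr (.inl _) => .refl _
  | .inr (.inr (.inl _)) => loopPow s.p j
  | .inr (.inr (.inr _)) => .refl _

theorem two_le_of_lower (x : Fin s.lower) : 2 ≤ T.wt s.e₁ := by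
  have := x.2
  unfold lower at this
  omega

/-- Balance of weights at the exterior product vertex. If `e₁` has weight one the lower leg is
absent, since an edge of weight zero is not allowed. -/
theorem lower_mul_add_one : s.lower * (T.wt s.e₁ - 1) + 1 = T.wt s.e₁ := by
  have h1 := T.one_le_wt s.e₁
  unfold lower
  obtain h | h : T.wt s.e₁ = 1 ∨ 1 ≤ T.wt s.e₁ - 1 := by omega
  · simp [h]
  · rw [min_eq_right h]
    omega

/-- An edge leaving an old vertex is neither `e₁` nor `e₂`, as these started at a puncture. Thus no
path returns from the old part to the new vertices, and no new cycle through an old vertex can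
arise. -/
theorem transGen_inl {v : T.V} {y : s.V}
    (h : Relation.TransGen (fun x y => ∃ e, s.src e = .inner x ∧ s.tgt e = y) (.inl v) y) :
    ∃ w, y = .inl w ∧ Relation.TransGen (fun x y => ∃ e, T.src e = .inner x ∧ T.tgt e = y) v w := by
  have step {v : T.V} {y : s.V} (h : ∃ e, s.src e = .inner (.inl v) ∧ s.tgt e = y) :
      ∃ w, y = .inl w ∧ ∃ e, T.src e = .inner v ∧ T.tgt e = w := by
    obtain ⟨e | e | e | e, h1, rfl⟩ := h
    · exact ⟨_, rfl, e, s.src_inl_eq_inner_inl.1 h1, rfl⟩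
    all_goals simp [src] at h1
  induction h with
  | single h =>
    obtain ⟨w, rfl, h'⟩ := step h
    exact ⟨w, rfl, .single h'⟩
  | tail _ h ih =>
    obtain ⟨w, rfl, ih⟩ := ih
    obtain ⟨w', rfl, h'⟩ := step h
    exact ⟨w', rfl, ih.tail h'⟩

theorem not_rel_false (x : s.V) :
    ¬ ∃ e, s.src e = .inner x ∧ s.tgt e = (.inr false : s.V) := by
  rintro ⟨e | e | e | e, h1, h2⟩ <;> simp [src, tgt] at h1 h2

theorem eq_false_of_rel_true {x : s.V}
    (h : ∃ e, s.src e = .inner x ∧ s.tgt e = (.inr true : s.V)) : x = .inr false := by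
  obtain ⟨e | e | e | e, h1, h2⟩ := h <;> simp [src, tgt] at h1 h2
  exact h1.symm

/-- The diagram in which `i` has been exchanged between the two legs. -/
def diagram (j : ℕ) : M.TensorDiagram k c where
  V := s.V
  E := s.E
  kind := s.kind
  pos := s.pos
  pos_interior
    | .inl v => T.pos_interior v
    | .inr _ => isInteriorPoint_punctureBase s.p
  src := s.src
  tgt := s.tgt
  arc := s.arc j
  wt := s.wt
  one_le_wt
    | .inl e => T.one_le_wt e
    | .inr (.inl _) => Nat.le_add_left _ _
    | .inr (.inr (.inl _)) => le_rfl
    | .inr (.inr (.inr x)) => Nat.le_sub_of_add_le (s.two_le_of_lower x)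
  wt_le
    | .inl e => T.wt_le e
    | .inr (.inl _) => s.wt_lt
    | .inr (.inr (.inl _)) => (Nat.le_add_left _ _).trans s.wt_lt
    | .inr (.inr (.inr x)) => (Nat.sub_le _ _).trans (T.wt_le _)
  wt_boundary hc e q h := by
    obtain e | e | e | e := e
    · by_cases h₁ : e = s.e₁
      · subst h₁
        simp [src_inl_e₁] at h
      by_cases h₂ : e = s.e₂
      · subst h₂
        simp [src_inl_e₂] at h
      rw [s.src_inl_of_ne h₁ h₂, Vertex.map_eq_boundary] at h
      exact T.wt_boundary hc e q h
    all_goals simp [src] at h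
  inEdges := s.inEdges
  outEdges := s.outEdges
  nodup_inEdges
    | .inl v => (T.nodup_inEdges v).map Sum.inl_injective
    | .inr false => List.nodup_singleton _
    | .inr true => by
      refine List.Nodup.append ((List.nodup_finRange _).map fun x y h => by simpa using h)
        (List.nodup_singleton _) ?_
      simp
  nodup_outEdges
    | .inl v => (T.nodup_outEdges v).map Sum.inl_injective
    | .inr false => by simp [outEdges]
    | .inr true => List.nodup_singleton _
  mem_inEdges v e := by
    obtain v | _ | _ := v <;> obtain e | e | e | e := e <;>
      simp [inEdges, tgt, T.mem_inEdges]
  mem_outEdges v e := by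
    obtain v | _ | _ := v
    · obtain e | e | e | e := e
      · simp [outEdges, T.mem_outEdges, s.src_inl_eq_inner_inl]
      all_goals simp [outEdges, src]
    · obtain e | e | e | e := e
      · by_cases h₁ : e = s.e₁
        · subst h₁
          simp [outEdges, src_inl_e₁, s.ne.symm]
        by_cases h₂ : e = s.e₂
        · subst h₂
          simp [outEdges, src_inl_e₂]
        rw [s.src_inl_of_ne h₁ h₂, Vertex.map_eq_inner]
        simp [outEdges, h₂]
      all_goals simp [outEdges, src]
    · obtain e | e | e | e := e
      · by_cases h₁ : e = s.e₁
        · subst h₁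
          simp [outEdges, src_inl_e₁]
        by_cases h₂ : e = s.e₂
        · subst h₂
          simp [outEdges, src_inl_e₂, s.ne]
        rw [s.src_inl_of_ne h₁ h₂, Vertex.map_eq_inner]
        simp [outEdges, h₁]
      all_goals simp [outEdges, src]
  admissible
    | .inl v => by
      have := T.admissible v
      simp only [inEdges, outEdges, List.map_map]
      exact this
    | .inr false => by
      simp [kind, VertexKind.Admissible, inEdges, outEdges, wt, exchangeWt, add_comm]
    | .inr true => by
      have h1 := s.lower_mul_add_one
      simpa [kind, VertexKind.Admissible, inEdges, outEdges, wt, exchangeWt, Function.comp_def]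
        using h1.symm
  acyclic v h := by
    obtain v | _ | _ := v
    · obtain ⟨w, hw, h⟩ := s.transGen_inl h
      obtain rfl := Sum.inl.inj hw
      exact T.acyclic v h
    · obtain ⟨_, -, h⟩ := Relation.TransGen.tail'_iff.1 h
      exact s.not_rel_false _ h
    · obtain ⟨x, h1, h2⟩ := Relation.TransGen.tail'_iff.1 h
      rw [s.eq_false_of_rel_true h2] at h1
      obtain h1 | ⟨y, -, h1⟩ := Relation.ReflTransGen.cases_tail_iff _ _ _ |>.1 h1
      · simp at h1
      · exact s.not_rel_false _ h1

/-- The pseudotagging of the diagram in which `i` has been exchanged between the two legs. -/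
def pseudotagging (j : ℕ) : (s.diagram j).Pseudotagging where
  tag
    | ⟨.inl e, h⟩ => φ.tag ⟨e, h.imp fun _ h => (s.src_inl_eq_puncture h).2.2⟩
    | ⟨.inr (.inl _), _⟩ => insert s.i s.setB
    -- The winding edge does not start at a puncture, so this case is void; any set with one element
    -- would do.
    | ⟨.inr (.inr (.inl _)), _⟩ => {s.i}
    | ⟨.inr (.inr (.inr _)), _⟩ => s.setA.erase s.i
  card_tag
    | ⟨.inl _, _⟩ => φ.card_tag _
    | ⟨.inr (.inl _), _⟩ => s.card_insert
    | ⟨.inr (.inr (.inl _)), _⟩ => Finset.card_singleton _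
    | ⟨.inr (.inr (.inr _)), _⟩ => s.card_erase

end ExchangeSite

end TensorDiagram

end MarkedSurface
end

/-! ### The exchange relation for invariants and the reduction to taggings -/

noncomputable section

open ExtAlg

namespace MarkedSurface

variable {S : Type*} [TopologicalSpace S] [ChartedSpace (EuclideanHalfSpace 2) S]
  [IsManifold (𝓡∂ 2) ∞ S] {M : MarkedSurface S} {k : ℕ} {c : Flavor}

namespace TensorDiagram

namespace ExchangeSite

variable {T : M.TensorDiagram k c} {φ : T.Pseudotagging} (s : ExchangeSite φ)
  (z : M.DecoratedLocalSystem k c)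

/-- The factors of the state sum at the sources of the edges other than the two legs. -/
def restCoeff (e : T.E) (I : Finset (Fin k)) : ℂ :=
  if e = s.e₁ then 1 else if e = s.e₂ then 1 else sourceCoeff φ z e I

theorem prod_sourceCoeff (I : T.E → Finset (Fin k)) :
    ∏ e, sourceCoeff φ z e (I e) = (∏ e, s.restCoeff z e (I e)) *
      (ExtAlg.coeff (I s.e₁) (legTensor (z.monodromy s.p) (z.flag s.p) s.setA) *
        ExtAlg.coeff (I s.e₂) (legTensor (z.monodromy s.p) (z.flag s.p) s.setB)) := by
  have h (e : T.E) : sourceCoeff φ z e (I e) = s.restCoeff z e (I e) *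
      ((if e = s.e₁ then ExtAlg.coeff (I e)
        (legTensor (z.monodromy s.p) (z.flag s.p) s.setA) else 1) *
      (if e = s.e₂ then ExtAlg.coeff (I e)
        (legTensor (z.monodromy s.p) (z.flag s.p) s.setB) else 1)) := by
    unfold restCoeff
    by_cases h₁ : e = s.e₁
    · subst h₁
      rw [if_pos rfl, if_pos rfl, if_neg s.ne.symm, sourceCoeff_puncture φ z s.src₁]
      simp [setA]
    by_cases h₂ : e = s.e₂
    · subst h₂
      rw [if_neg h₁, if_pos rfl, if_neg h₁, if_pos rfl, sourceCoeff_puncture φ z s.src₂]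
      simp [setB]
    simp [h₁, h₂]
  simp only [h, Finset.prod_mul_distrib, Finset.prod_ite_eq', Finset.mem_univ, if_true]

/-- The detached legs start at inner vertices and contribute `1`; all other old edges keep their
sources and tags. -/
theorem sourceCoeff_inl (j : ℕ) (e : T.E) (I : Finset (Fin k)) :
    sourceCoeff (s.pseudotagging j) z (.inl e : s.E) I = s.restCoeff z e I := by
  unfold restCoeff
  by_cases h₁ : e = s.e₁
  · subst h₁
    rw [if_pos rfl]
    exact sourceCoeff_inner _ z s.src_inl_e₁ I
  by_cases h₂ : e = s.e₂
  · subst h₂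
    rw [if_neg h₁, if_pos rfl]
    exact sourceCoeff_inner _ z s.src_inl_e₂ I
  rw [if_neg h₁, if_neg h₂]
  have hs := s.src_inl_of_ne h₁ h₂
  cases h : T.src e with
  | inner v =>
    rw [h] at hs
    rw [sourceCoeff_inner φ z h]
    exact sourceCoeff_inner _ z hs I
  | puncture p =>
    rw [h] at hs
    rw [sourceCoeff_puncture φ z h]
    exact sourceCoeff_puncture _ z hs I
  | boundary q =>
    rw [h] at hs
    rw [sourceCoeff_boundary φ z h]
    exact sourceCoeff_boundary _ z hs I

theorem sourceCoeff_inr (j : ℕ) (x : Unit ⊕ Unit ⊕ Fin s.lower) (I : Finset (Fin k)) :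
    sourceCoeff (s.pseudotagging j) z (.inr x : s.E) I =
      exchangeSource (legTensor (z.monodromy s.p) (z.flag s.p) (insert s.i s.setB))
        (legTensor (z.monodromy s.p) (z.flag s.p) (s.setA.erase s.i)) x I := by
  obtain x | x | x := x
  · exact sourceCoeff_puncture (T := s.diagram j) _ z (e := .inr (.inl x)) (p := s.p) rfl I
  · exact sourceCoeff_inner (T := s.diagram j) _ z (e := .inr (.inr (.inl x)))
      (v := .inr false) rfl I
  · exact sourceCoeff_puncture (T := s.diagram j) _ z (e := .inr (.inr (.inr x))) (p := s.p) rfl I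

theorem transport_arc_inl (j : ℕ) (e : T.E) :
    z.transport (s.arc j (.inl e)) = z.transport (T.arc e) :=
  z.transport_cast _ (s.location_src_inl e)

theorem transport_arc_inr (j : ℕ) (x : Unit ⊕ Unit ⊕ Fin s.lower) :
    z.transport (s.arc j (.inr x)) = exchangeTransport (z.monodromy s.p ^ j) x := by
  obtain x | x | x := x
  · exact z.transport_refl _
  · exact z.transport_loopPow _ _
  · exact z.transport_refl _

/-- The labels of the new edges can be summed separately. They meet the old state sum only in the
starting labels of `e₁` and `e₂`, so the exchange relation reduces to an identity of tensors at the
puncture. -/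
theorem value_pseudotagging (j : ℕ) :
    value (s.pseudotagging j) z =
      ∑ I ∈ Fintype.piFinset fun e => Finset.powersetCard (T.wt e) (Finset.univ : Finset (Fin k)),
      ∑ J ∈ Fintype.piFinset fun e => Finset.powersetCard (T.wt e) (Finset.univ : Finset (Fin k)),
        ((∏ e, s.restCoeff z e (I e)) *
          exchangeTensor (T.wt s.e₂ + 1) (T.wt s.e₁ - 1) s.lower
            (legTensor (z.monodromy s.p) (z.flag s.p) (insert s.i s.setB))
            (legTensor (z.monodromy s.p) (z.flag s.p) (s.setA.erase s.i))
            (z.monodromy s.p ^ j) (I s.e₁) (I s.e₂)) *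
        (∏ e, ExtAlg.coeff (J e) (ExtAlg.act (z.transport (T.arc e)) (ExtAlg.stdBasis k (I e)))) *
        (∏ v, (T.kind v).coeff ((T.inEdges v).map J) ((T.outEdges v).map I)) := by
  have h : value (s.pseudotagging j) z =
      ∑ I ∈ Fintype.piFinset fun e : s.E =>
        Finset.powersetCard (s.wt e) (Finset.univ : Finset (Fin k)),
      ∑ J ∈ Fintype.piFinset fun e : s.E =>
        Finset.powersetCard (s.wt e) (Finset.univ : Finset (Fin k)),
        (∏ e : s.E, sourceCoeff (s.pseudotagging j) z e (I e)) *
        (∏ e : s.E, ExtAlg.coeff (J e)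
          (ExtAlg.act (z.transport (s.arc j e)) (ExtAlg.stdBasis k (I e)))) *
        (∏ v : s.V, (s.kind v).coeff ((s.inEdges v).map J) ((s.outEdges v).map I)) := rfl
  rw [h, sum_piFinset_sum]
  refine Finset.sum_congr rfl fun I _ => ?_
  simp only [sum_piFinset_sum (α := T.E)]
  rw [Finset.sum_comm]
  refine Finset.sum_congr rfl fun J _ => ?_
  unfold exchangeTensor
  rw [Finset.mul_sum, Finset.sum_mul, Finset.sum_mul]
  refine Finset.sum_congr rfl fun I' _ => ?_
  rw [Finset.mul_sum, Finset.sum_mul, Finset.sum_mul]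
  refine Finset.sum_congr rfl fun J' _ => ?_
  simp only [Fintype.prod_sum_type, Fintype.prod_bool, sourceCoeff_inl, sourceCoeff_inr,
    transport_arc_inl, transport_arc_inr, Sum.elim_inl, Sum.elim_inr, kind, inEdges, outEdges,
    List.map_map, List.map_append, List.map_cons, List.map_nil, Function.comp_def]
  ring

/-- The exchange relation between diagram invariants. -/
theorem value_eq_sum (hk : 1 ≤ k) (hz : (z.flag s.p).IsGeneric (z.monodromy s.p))
    (hle : T.wt s.e₁ ≤ T.wt s.e₂ + 1) :
    value φ z = ∑ j ∈ Finset.range (T.wt s.e₂ + 1 - T.wt s.e₁ + 1),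
      ((-1 : ℂ) ^ (T.wt s.e₂ + 1 - T.wt s.e₁ - j) * (T.wt s.e₂ + 1 - T.wt s.e₁).choose j) *
        value (s.pseudotagging j) z := by
  have hs : (z.flag s.p).IsStabilizedBy (z.monodromy s.p) := z.flag_stabilized s.p
  have hU := hz.legTensor_mem hk hs (insert s.i s.setB)
  have hL := hz.legTensor_mem hk hs (s.setA.erase s.i)
  rw [s.card_insert] at hU
  rw [s.card_erase] at hL
  -- The lower leg is missing only if the remaining set is empty, whose tensor is the unit `1`.
  have hl0 : s.lower = 0 → legTensor (z.monodromy s.p) (z.flag s.p) (s.setA.erase s.i) = 1 := by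
    intro h
    have h1 : s.setA.erase s.i = ∅ := by
      rw [← Finset.card_eq_zero, s.card_erase]
      unfold lower at h
      omega
    obtain ⟨y, x, hy, hx, hF⟩ := hz.exists_jordanFrame hk hs
    rw [h1, hF.legTensor_eq hy hx]
    simp [wedgePrefix]
  have key (K₁ K₂ : Finset (Fin k)) := hz.legTensor_exchange hk hs (A := s.setA) (B := s.setB)
    s.mem s.notMem (by rw [s.card_setA, s.card_setB]; exact hle) K₁ K₂
  simp only [s.card_setA, s.card_setB] at key
  simp only [value_pseudotagging]
  have hl1 : s.lower ≤ 1 := min_le_right _ _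
  simp only [exchangeTensor_eq _ hU hL hl1 hl0]
  unfold value
  simp only [s.prod_sourceCoeff, Finset.mul_sum (s := Fintype.piFinset _)]
  symm
  rw [Finset.sum_comm]
  refine Finset.sum_congr rfl fun I _ => ?_
  rw [Finset.sum_comm]
  refine Finset.sum_congr rfl fun J _ => ?_
  symm
  -- For fixed labels of the old edges only the pair of coefficients at `e₁` and `e₂` differs, and
  -- `key` expands exactly that pair.
  rw [← key, Finset.mul_sum, Finset.sum_mul, Finset.sum_mul]
  refine Finset.sum_congr rfl fun j _ => ?_
  ring

end ExchangeSite

/-- The contribution `k² - a²` of an edge of weight `a` at a puncture to `legMeasure`. -/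
def _root_.MarkedSurface.Vertex.legMeasure {V : Type} (k a : ℕ) : M.Vertex V → ℕ
  | .puncture _ => k ^ 2 - a ^ 2
  | _ => 0

/-- The measure which decreases when elements are exchanged: the sum of `k² - a²` over the weights
`a` of all legs. -/
def legMeasure (T : M.TensorDiagram k c) : ℕ :=
  ∑ e, (T.src e).legMeasure k (T.wt e)

/-- For `a ≤ b` the sum of squares grows: `(a - 1)² + (b + 1)² = a² + b² + 2 (b - a) + 2`. A lower
leg that disappears takes away a further nonnegative amount. -/
theorem ExchangeSite.legMeasure_lt {T : M.TensorDiagram k c} {φ : T.Pseudotagging}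
    (s : ExchangeSite φ) (hle : T.wt s.e₁ ≤ T.wt s.e₂) (j : ℕ) :
    (s.diagram j).legMeasure < T.legMeasure := by
  have h1 : T.legMeasure =
      (∑ e, if e = s.e₁ then 0 else if e = s.e₂ then 0 else (T.src e).legMeasure k (T.wt e)) +
        ((k ^ 2 - T.wt s.e₁ ^ 2) + (k ^ 2 - T.wt s.e₂ ^ 2)) := by
    have h (e : T.E) : (T.src e).legMeasure k (T.wt e) =
        (if e = s.e₁ then 0 else if e = s.e₂ then 0 else (T.src e).legMeasure k (T.wt e)) +
          ((if e = s.e₁ then k ^ 2 - T.wt e ^ 2 else 0) +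
          (if e = s.e₂ then k ^ 2 - T.wt e ^ 2 else 0)) := by
      by_cases h₁ : e = s.e₁
      · subst h₁
        simp [s.src₁, s.ne.symm, Vertex.legMeasure]
      by_cases h₂ : e = s.e₂
      · subst h₂
        simp [s.src₂, s.ne, Vertex.legMeasure]
      simp [h₁, h₂]
    unfold legMeasure
    rw [Finset.sum_congr rfl fun e _ => h e]
    simp only [Finset.sum_add_distrib, Finset.sum_ite_eq', Finset.mem_univ, if_true]
  have h2 : (s.diagram j).legMeasure =
      (∑ e, if e = s.e₁ then 0 else if e = s.e₂ then 0 else (T.src e).legMeasure k (T.wt e)) +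
        ((k ^ 2 - (T.wt s.e₂ + 1) ^ 2) +
          s.lower * (k ^ 2 - (T.wt s.e₁ - 1) ^ 2)) := by
    have h : (s.diagram j).legMeasure = ∑ e : s.E, (s.src e).legMeasure k (s.wt e) := rfl
    rw [h, Fintype.sum_sum_type]
    congr 1
    · refine Finset.sum_congr rfl fun e _ => ?_
      by_cases h₁ : e = s.e₁
      · subst h₁
        simp [s.src_inl_e₁, Vertex.legMeasure]
      by_cases h₂ : e = s.e₂
      · subst h₂
        simp [s.src_inl_e₂, Vertex.legMeasure]
      rw [if_neg h₁, if_neg h₂, s.src_inl_of_ne h₁ h₂]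
      cases T.src e <;> rfl
    · simp [Fintype.sum_sum_type, ExchangeSite.src, ExchangeSite.wt, exchangeWt,
        Vertex.legMeasure]
  rw [h1, h2]
  refine Nat.add_lt_add_left ?_ _
  have hw₁ := T.one_le_wt s.e₁
  have hw₂ := s.wt_lt
  unfold ExchangeSite.lower
  generalize T.wt s.e₁ = a at *
  generalize T.wt s.e₂ = b at *
  obtain ⟨a, rfl⟩ : ∃ a', a = a' + 1 := ⟨a - 1, by omega⟩
  have hb : (b + 1) ^ 2 ≤ k ^ 2 := Nat.pow_le_pow_left hw₂ 2
  have ha : (a + 1) ^ 2 ≤ b ^ 2 := Nat.pow_le_pow_left hle 2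
  have e1 : (b + 1) ^ 2 = b ^ 2 + 2 * b + 1 := by ring
  have e2 : (a + 1) ^ 2 = a ^ 2 + 2 * a + 1 := by ring
  have : min (a + 1 - 1) 1 * (k ^ 2 - (a + 1 - 1) ^ 2) ≤ k ^ 2 - a ^ 2 := by
    rw [Nat.add_sub_cancel]
    calc min a 1 * (k ^ 2 - a ^ 2) ≤ 1 * (k ^ 2 - a ^ 2) :=
          Nat.mul_le_mul_right _ (min_le_right _ _)
      _ = _ := one_mul _
  omega

/-- If a pseudotagging is not a tagging, then some element can be exchanged. -/
theorem exists_exchangeSite {T : M.TensorDiagram k c} {φ : T.Pseudotagging}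
    (h : ¬ φ.IsTagging) : ∃ s : ExchangeSite φ, T.wt s.e₁ ≤ T.wt s.e₂ := by
  unfold Pseudotagging.IsTagging at h
  push Not at h
  obtain ⟨p, ⟨e, he⟩, ⟨e', he'⟩, h1, h2, h3, h4⟩ := h
  obtain ⟨i, hi, hi'⟩ := Finset.not_subset.1 h3
  obtain ⟨j, hj, hj'⟩ := Finset.not_subset.1 h4
  -- Incomparability provides an element to move in either direction; moving it away from the leg of
  -- smaller weight is what lowers the measure.
  rcases le_total (T.wt e) (T.wt e') with h | h
  · exact ⟨⟨p, e, e', h1, h2, i, hi, hi'⟩, h⟩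
  · exact ⟨⟨p, e', e, h2, h1, j, hj, hj'⟩, h⟩

/-- An exchange may create new incomparable pairs with other legs, so the induction runs over a
measure of the whole diagram and not over the number of bad pairs. -/
theorem invariant_mem_span (hk : 1 ≤ k) (T : M.TensorDiagram k c) (φ : T.Pseudotagging) :
    invariant φ ∈ Submodule.span ℚ (M.taggedInvariants k c) := by
  induction hn : T.legMeasure using Nat.strong_induction_on generalizing T φ with
  | _ n ih =>
    by_cases h : φ.IsTagging
    · exact Submodule.subset_span ⟨T, φ, h, rfl⟩
    obtain ⟨s, hs⟩ := exists_exchangeSite h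
    have key : invariant φ = ∑ j ∈ Finset.range (T.wt s.e₂ + 1 - T.wt s.e₁ + 1),
        ((-1 : ℚ) ^ (T.wt s.e₂ + 1 - T.wt s.e₁ - j) * (T.wt s.e₂ + 1 - T.wt s.e₁).choose j) •
          invariant (s.pseudotagging j) := by
      funext z
      rw [invariant, s.value_eq_sum z.1 hk (z.2 s.p) (by omega), Finset.sum_apply]
      refine Finset.sum_congr rfl fun j _ => ?_
      rw [Pi.smul_apply, Algebra.smul_def]
      simp [invariant]
    rw [key]
    refine Submodule.sum_mem _ fun j _ => Submodule.smul_mem _ _ ?_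
    exact ih _ (hn ▸ s.legMeasure_lt hs j) _ _ rfl

end TensorDiagram

end MarkedSurface
end

/-! ### Superposition of diagrams and the skein algebra -/

noncomputable section

open ExtAlg

namespace MarkedSurface

variable {S : Type*} [TopologicalSpace S] [ChartedSpace (EuclideanHalfSpace 2) S]
  [IsManifold (𝓡∂ 2) ∞ S] {M : MarkedSurface S} {k : ℕ} {c : Flavor}

namespace TensorDiagram

section Union

variable (T₁ T₂ : M.TensorDiagram k c)

/-- The sources of the edges of a disjoint union. -/
def unionSrc : T₁.E ⊕ T₂.E → M.Vertex (T₁.V ⊕ T₂.V)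
  | .inl e => (T₁.src e).map .inl
  | .inr e => (T₂.src e).map .inr

def unionArc : ∀ e, M.Arc ((unionSrc T₁ T₂ e).location (Sum.elim T₁.pos T₂.pos))
    (Sum.elim T₁.pos T₂.pos (Sum.map T₁.tgt T₂.tgt e))
  | .inl e => (T₁.arc e).cast (Vertex.location_map _ _ _) rfl
  | .inr e => (T₂.arc e).cast (Vertex.location_map _ _ _) rfl

def unionInEdges : T₁.V ⊕ T₂.V → List (T₁.E ⊕ T₂.E)
  | .inl v => (T₁.inEdges v).map .inl
  | .inr v => (T₂.inEdges v).map .inr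

def unionOutEdges : T₁.V ⊕ T₂.V → List (T₁.E ⊕ T₂.E)
  | .inl v => (T₁.outEdges v).map .inl
  | .inr v => (T₂.outEdges v).map .inr

theorem transGen_union {x y : T₁.V ⊕ T₂.V}
    (h : Relation.TransGen
      (fun x y => ∃ e, unionSrc T₁ T₂ e = .inner x ∧ Sum.map T₁.tgt T₂.tgt e = y) x y) :
    Sum.LiftRel (Relation.TransGen fun x y => ∃ e, T₁.src e = .inner x ∧ T₁.tgt e = y)
      (Relation.TransGen fun x y => ∃ e, T₂.src e = .inner x ∧ T₂.tgt e = y) x y := by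
  have step {x y : T₁.V ⊕ T₂.V}
      (h : ∃ e, unionSrc T₁ T₂ e = .inner x ∧ Sum.map T₁.tgt T₂.tgt e = y) :
      Sum.LiftRel (fun x y => ∃ e, T₁.src e = .inner x ∧ T₁.tgt e = y)
        (fun x y => ∃ e, T₂.src e = .inner x ∧ T₂.tgt e = y) x y := by
    obtain ⟨e | e, h1, rfl⟩ := h <;> obtain ⟨v, hv, rfl⟩ := Vertex.map_eq_inner.1 h1
    · exact .inl ⟨e, hv, rfl⟩
    · exact .inr ⟨e, hv, rfl⟩
  induction h with
  | single h => exact (step h).mono (fun _ _ => .single) fun _ _ => .single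
  | tail _ h ih =>
    cases ih with
    | inl ih => cases step h with | inl h' => exact .inl (ih.tail h')
    | inr ih => cases step h with | inr h' => exact .inr (ih.tail h')

/-- The disjoint union (superposition) of two tensor diagrams. -/
def union : M.TensorDiagram k c where
  V := T₁.V ⊕ T₂.V
  E := T₁.E ⊕ T₂.E
  kind := Sum.elim T₁.kind T₂.kind
  pos := Sum.elim T₁.pos T₂.pos
  pos_interior
    | .inl v => T₁.pos_interior v
    | .inr v => T₂.pos_interior v
  src := unionSrc T₁ T₂
  tgt := Sum.map T₁.tgt T₂.tgt
  arc := unionArc T₁ T₂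
  wt := Sum.elim T₁.wt T₂.wt
  one_le_wt
    | .inl e => T₁.one_le_wt e
    | .inr e => T₂.one_le_wt e
  wt_le
    | .inl e => T₁.wt_le e
    | .inr e => T₂.wt_le e
  wt_boundary hc
    | .inl e, q, h => T₁.wt_boundary hc e q (Vertex.map_eq_boundary.1 h)
    | .inr e, q, h => T₂.wt_boundary hc e q (Vertex.map_eq_boundary.1 h)
  inEdges := unionInEdges T₁ T₂
  outEdges := unionOutEdges T₁ T₂
  nodup_inEdges
    | .inl v => (T₁.nodup_inEdges v).map Sum.inl_injective
    | .inr v => (T₂.nodup_inEdges v).map Sum.inr_injective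
  nodup_outEdges
    | .inl v => (T₁.nodup_outEdges v).map Sum.inl_injective
    | .inr v => (T₂.nodup_outEdges v).map Sum.inr_injective
  mem_inEdges v e := by
    obtain v | v := v <;> obtain e | e := e <;>
      simp [unionInEdges, T₁.mem_inEdges, T₂.mem_inEdges]
  mem_outEdges v e := by
    obtain v | v := v <;> obtain e | e := e <;>
      simp [unionOutEdges, unionSrc, T₁.mem_outEdges, T₂.mem_outEdges, Vertex.map_eq_inner]
  admissible
    | .inl v => by
      simp only [unionInEdges, unionOutEdges, List.map_map]
      exact T₁.admissible v
    | .inr v => by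
      simp only [unionInEdges, unionOutEdges, List.map_map]
      exact T₂.admissible v
  acyclic v h := by
    cases transGen_union T₁ T₂ h with
    | inl h => exact T₁.acyclic _ h
    | inr h => exact T₂.acyclic _ h

variable {T₁ T₂}

/-- The pseudotagging of a disjoint union given by pseudotaggings of both parts. -/
def Pseudotagging.union (φ₁ : T₁.Pseudotagging) (φ₂ : T₂.Pseudotagging) :
    (T₁.union T₂).Pseudotagging where
  tag
    | ⟨.inl e, h⟩ => φ₁.tag ⟨e, h.imp fun _ h => Vertex.map_eq_puncture.1 h⟩
    | ⟨.inr e, h⟩ => φ₂.tag ⟨e, h.imp fun _ h => Vertex.map_eq_puncture.1 h⟩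
  card_tag
    | ⟨.inl _, _⟩ => φ₁.card_tag _
    | ⟨.inr _, _⟩ => φ₂.card_tag _

variable (φ₁ : T₁.Pseudotagging) (φ₂ : T₂.Pseudotagging) (z : M.DecoratedLocalSystem k c)

theorem sourceCoeff_union_inl (e : T₁.E) (I : Finset (Fin k)) :
    sourceCoeff (φ₁.union φ₂) z (.inl e : T₁.E ⊕ T₂.E) I = sourceCoeff φ₁ z e I := by
  have hs : unionSrc T₁ T₂ (.inl e) = (T₁.src e).map .inl := rfl
  cases h : T₁.src e with
  | inner v =>
    rw [h] at hs
    rw [sourceCoeff_inner φ₁ z h]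
    exact sourceCoeff_inner _ z hs I
  | puncture p =>
    rw [h] at hs
    rw [sourceCoeff_puncture φ₁ z h]
    exact sourceCoeff_puncture _ z hs I
  | boundary q =>
    rw [h] at hs
    rw [sourceCoeff_boundary φ₁ z h]
    exact sourceCoeff_boundary _ z hs I

theorem sourceCoeff_union_inr (e : T₂.E) (I : Finset (Fin k)) :
    sourceCoeff (φ₁.union φ₂) z (.inr e : T₁.E ⊕ T₂.E) I = sourceCoeff φ₂ z e I := by
  have hs : unionSrc T₁ T₂ (.inr e) = (T₂.src e).map .inr := rfl
  cases h : T₂.src e with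
  | inner v =>
    rw [h] at hs
    rw [sourceCoeff_inner φ₂ z h]
    exact sourceCoeff_inner _ z hs I
  | puncture p =>
    rw [h] at hs
    rw [sourceCoeff_puncture φ₂ z h]
    exact sourceCoeff_puncture _ z hs I
  | boundary q =>
    rw [h] at hs
    rw [sourceCoeff_boundary φ₂ z h]
    exact sourceCoeff_boundary _ z hs I

theorem transport_unionArc_inl (e : T₁.E) :
    z.transport (unionArc T₁ T₂ (.inl e)) = z.transport (T₁.arc e) :=
  z.transport_cast _ (Vertex.location_map Sum.inl (Sum.elim T₁.pos T₂.pos) (T₁.src e))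

theorem transport_unionArc_inr (e : T₂.E) :
    z.transport (unionArc T₁ T₂ (.inr e)) = z.transport (T₂.arc e) :=
  z.transport_cast _ (Vertex.location_map Sum.inr (Sum.elim T₁.pos T₂.pos) (T₂.src e))

/-- No edge or vertex involves both diagrams, so labellings are pairs of labellings and every
summand factors. -/
theorem value_union : value (φ₁.union φ₂) z = value φ₁ z * value φ₂ z := by
  have h : value (φ₁.union φ₂) z =
      ∑ I ∈ Fintype.piFinset fun e : T₁.E ⊕ T₂.E =>
        Finset.powersetCard (Sum.elim T₁.wt T₂.wt e) (Finset.univ : Finset (Fin k)),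
      ∑ J ∈ Fintype.piFinset fun e : T₁.E ⊕ T₂.E =>
        Finset.powersetCard (Sum.elim T₁.wt T₂.wt e) (Finset.univ : Finset (Fin k)),
        (∏ e : T₁.E ⊕ T₂.E, sourceCoeff (φ₁.union φ₂) z e (I e)) *
        (∏ e : T₁.E ⊕ T₂.E, ExtAlg.coeff (J e)
          (ExtAlg.act (z.transport (unionArc T₁ T₂ e)) (ExtAlg.stdBasis k (I e)))) *
        (∏ v : T₁.V ⊕ T₂.V, (Sum.elim T₁.kind T₂.kind v).coeff
          ((unionInEdges T₁ T₂ v).map J) ((unionOutEdges T₁ T₂ v).map I)) := rfl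
  rw [h, sum_piFinset_sum]
  simp only [sum_piFinset_sum (α := T₁.E)]
  unfold value
  rw [Finset.sum_mul_sum]
  refine Finset.sum_congr rfl fun I _ => Finset.sum_congr rfl fun I' _ => ?_
  rw [Finset.sum_mul_sum]
  refine Finset.sum_congr rfl fun J _ => Finset.sum_congr rfl fun J' _ => ?_
  simp only [Fintype.prod_sum_type, sourceCoeff_union_inl, sourceCoeff_union_inr,
    transport_unionArc_inl, transport_unionArc_inr, Sum.elim_inl, Sum.elim_inr, unionInEdges,
    unionOutEdges, List.map_map, Function.comp_def]
  ring

end Union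

/-- The empty tensor diagram. -/
def empty (M : MarkedSurface S) (k : ℕ) (c : Flavor) : M.TensorDiagram k c where
  V := Empty
  E := Empty
  kind := Empty.elim
  pos := Empty.elim
  pos_interior v := v.elim
  src := Empty.elim
  tgt := Empty.elim
  arc e := e.elim
  wt := Empty.elim
  one_le_wt e := e.elim
  wt_le e := e.elim
  wt_boundary _ e := e.elim
  inEdges := Empty.elim
  outEdges := Empty.elim
  nodup_inEdges v := v.elim
  nodup_outEdges v := v.elim
  mem_inEdges v := v.elim
  mem_outEdges v := v.elim
  admissible v := v.elim
  acyclic v := v.elim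

/-- The pseudotagging of the empty diagram. -/
def emptyPseudotagging (M : MarkedSurface S) (k : ℕ) (c : Flavor) :
    (empty M k c).Pseudotagging where
  tag e := Empty.elim e.1
  card_tag e := Empty.elim e.1

theorem value_emptyPseudotagging (z : M.DecoratedLocalSystem k c) :
    value (emptyPseudotagging M k c) z = 1 := by
  have : IsEmpty (empty M k c).E := inferInstanceAs (IsEmpty Empty)
  have : IsEmpty (empty M k c).V := inferInstanceAs (IsEmpty Empty)
  unfold value
  rw [sum_piFinset_isEmpty, sum_piFinset_isEmpty]
  simp

end TensorDiagram

open TensorDiagram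

/-- The pseudotagged diagram invariants form a submonoid. -/
def pseudotaggedSubmonoid (M : MarkedSurface S) (k : ℕ) (c : Flavor) :
    Submonoid (M.GenericPoint k c → ℂ) where
  carrier := M.pseudotaggedInvariants k c
  one_mem' := ⟨_, emptyPseudotagging M k c, funext fun z => (value_emptyPseudotagging z.1).symm⟩
  mul_mem' := by
    rintro _ _ ⟨T₁, φ₁, rfl⟩ ⟨T₂, φ₂, rfl⟩
    exact ⟨_, φ₁.union φ₂, funext fun z => (value_union φ₁ φ₂ z.1).symm⟩

/-- Pseudotagged invariants are closed under products and contain `1`, so they already span the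
algebra they generate. Superposing taggings need not give a tagging, so the passage to tagged
invariants rests on `invariant_mem_span`, whose rational coefficients are also available in `R`. -/
theorem toSubmodule_taggedSkeinAlgebra (hk : 1 ≤ k) (R : Type) [CommRing R] [Algebra ℚ R]
    [Algebra R ℂ] :
    Subalgebra.toSubmodule (M.taggedSkeinAlgebra k c R) =
      Submodule.span R (M.taggedInvariants k c) := by
  have h : Submonoid.closure (M.pseudotaggedInvariants k c) = pseudotaggedSubmonoid M k c :=
    Submonoid.closure_eq (pseudotaggedSubmonoid M k c)
  rw [taggedSkeinAlgebra, Algebra.adjoin_eq_span, h]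
  refine le_antisymm (Submodule.span_le.2 ?_) (Submodule.span_mono ?_)
  · rintro _ ⟨T, φ, rfl⟩
    exact Submodule.span_le_restrictScalars ℚ R _ (invariant_mem_span hk T φ)
  · rintro _ ⟨T, φ, -, rfl⟩
    exact ⟨T, φ, rfl⟩

end MarkedSurface

end

open scoped Manifold ContDiff in
theorem theorem8p1 {S : Type*} [TopologicalSpace S] [T2Space S] [CompactSpace S]
    [ConnectedSpace S] [ChartedSpace (EuclideanHalfSpace 2) S] [IsManifold (𝓡∂ 2) ∞ S]
    (M : MarkedSurface S) (k : ℕ) (hk : 2 ≤ k) (c : Flavor) :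
    (∀ (T : M.TensorDiagram k c) (φ : T.Pseudotagging),
      MarkedSurface.TensorDiagram.invariant φ ∈ Submodule.span ℚ (M.taggedInvariants k c)) ∧
    Subalgebra.toSubmodule (M.taggedSkeinAlgebra k c ℚ) =
      Submodule.span ℚ (M.taggedInvariants k c) ∧
    Subalgebra.toSubmodule (M.taggedSkeinAlgebra k c ℂ) =
      Submodule.span ℂ (M.taggedInvariants k c) := by
  have hk' : 1 ≤ k := by omega
  exact ⟨MarkedSurface.TensorDiagram.invariant_mem_span hk',
    MarkedSurface.toSubmodule_taggedSkeinAlgebra hk' ℚ,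
    MarkedSurface.toSubmodule_taggedSkeinAlgebra hk' ℂ⟩
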